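/- Let $\mathcal U\subset\mathbb R^{M_1}$ be a linear subspace of dimension $r\ge 2$, and let $\mathbf D=[\mathbf B\ \mathbf A]\in\mathbb R^{M_1\times(n_o+n_i)}$ have independent random columns: the $n_o\ge 1$ columns $\mathbf d_1,\dots,\mathbf d_{n_o}$ of $\mathbf B$ (the outliers) are uniformly distributed on the unit sphere $\mathbb S^{M_1-1}$, and the $n_i$ columns $\mathbf d_{n_o+1},\dots,\mathbf d_{n_o+n_i}$ of $\mathbf A$ (the inliers) are uniformly distributed on $\mathcal U\cap\mathbb S^{M_1-1}$. For each column $\mathbf d_k$ let $\mathbf c_k^*$ be an optimal point of $\min_{\mathbf c}\|\mathbf D^T\mathbf c\|_1$ subject to $\mathbf c^T\mathbf d_k=1$; the Innovation Value of $\mathbf d_k$ is $1/\|\mathbf D^T\mathbf c_k^*\|_1$. Put $$\chi=\max_{1\le j\le n_o}\|\mathbf c_j^*\|_2,\qquad n_z'=\max_{1\le j\le n_o}\bigl|\{k\in\{1,\dots,n_o\}:\ \mathbf d_k^T\mathbf c_j^*=0\}\bigr| .$$ Let $0<\delta<1$ and $$\mathcal A=\sqrt{\tfrac1{2\pi}}\,\frac{n_i}{\sqrt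 r}-\sqrt{n_i}-\sqrt{\frac{n_i\log\frac1\delta}{2r-2}},$$ $$\sqrt{c_\delta}=3\max\Bigl(1,\sqrt{\tfrac{8M_1\pi}{(M_1-1)r}},\sqrt{\tfrac{8M_1\log (n_o/\delta)}{(M_1-1)r}}\Bigr),\qquad \sqrt{c''_\delta}=3\max\Bigl(1,\sqrt{\tfrac{8M_1\pi}{M_1-1}},\sqrt{\tfrac{16M_1\log (n_o/\delta)}{M_1-1}}\Bigr),$$ $$\eta_\delta=\max\Bigl(\tfrac43\log\tfrac{2M_1}{\delta},\sqrt{4\tfrac{n_o}{M_1}\log\tfrac{2M_1}{\delta}}\Bigr),$$ and suppose that $c_\delta r<M_1$ (so that the second condition below makes sense). Consider the three conditions $$\mathcal A>2n_z'\sqrt{\frac{c_\delta r}{M_1}}+2\sqrt{\frac{n_o c_\delta r\log (n_o/\delta)}{M_1}},$$ $$\mathcal A>\Bigl[\frac{n_o}{M_1}+\sqrt{\frac{4n_o}{M_1}}+\sqrt{\frac{2n_o\log (1/\delta)}{(M_1-1)M_1}}+\sqrt{\frac{n_o c''_\delta\log (n_o/\delta)}{M_1^2}}+n_z'\sqrt{\frac{c''_\delta}{M_1^2}}+\sqrt{\frac{n_o\log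 (n_o/\delta)}{M_1^2}+\frac{\eta_\delta\log (n_o/\delta)}{M_1}}\Bigr]\sqrt{\frac{4M_1c_\delta}{M_1-c_\delta r}},$$ $$\mathcal A>\chi\frac{n_o}{\sqrt{M_1}}+2\sqrt{n_o}\,(1+\sqrt\chi)+2\sqrt{\frac{2\chi n_o\log (1/\delta)}{M_1-1}} .$$ Then with probability at least $1-7\delta$ the following holds, whatever optimal points $\mathbf c_k^*$ are chosen: if the three conditions hold, then the Innovation Value of every inlier is strictly smaller than the Innovation Value of every outlier, $$\max_{n_o<i\le n_o+n_i}\frac1{\|\mathbf D^T\mathbf c_i^*\|_1}<\min_{1\le j\le n_o}\frac1{\|\mathbf D^T\mathbf c_j^*\|_1},$$ and $\mathcal U$ is recovered exactly. That is, there is a set of columns of $\mathbf D$ with the smallest Innovation Values (no column outside the set has a smaller Innovation Value than a column in it) that spans an $r$-dimensional subspace, and every such set of columns spans $\mathcal U$. -/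

import Mathlib

open MeasureTheory ProbabilityTheory

namespace InnovationSearch

/-- The uniform probability distribution on the unit sphere of a Euclidean space `F`: the
normalized surface measure, seen as a measure on `F`. -/
noncomputable def uniformSphere (F : Type*) [NormedAddCommGroup F] [InnerProductSpace ℝ F]
    [FiniteDimensional ℝ F] [MeasurableSpace F] [BorelSpace F] : Measure F :=
  ((volume : Measure F).toSphere Set.univ)⁻¹ •
    ((volume : Measure F).toSphere).map (Subtype.val : Metric.sphere (0 : F) 1 → F)

/-- The uniform probability distribution on `U ∩ S`, with `S` the unit sphere of the ambient
space. -/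
noncomputable def uniformSphereIn {M : ℕ} (U : Submodule ℝ (EuclideanSpace ℝ (Fin M))) :
    Measure (EuclideanSpace ℝ (Fin M)) :=
  (uniformSphere U).map (Subtype.val : U → EuclideanSpace ℝ (Fin M))

/-- The random data model: the columns of `D = [B A]` are independent, the columns of `B`
(the outliers, indexed by `Sum.inl`) are uniform on the unit sphere, and the columns of `A`
(the inliers, indexed by `Sum.inr`) are uniform on `U ∩ S`. -/
structure IsRandomData {Ω : Type*} [MeasurableSpace Ω] (P : Measure Ω) {M nₒ nᵢ : ℕ}
    (U : Submodule ℝ (EuclideanSpace ℝ (Fin M)))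
    (D : Fin nₒ ⊕ Fin nᵢ → Ω → EuclideanSpace ℝ (Fin M)) : Prop where
  measurable : ∀ k, Measurable (D k)
  indep : iIndepFun D P
  outlier_law : ∀ j, P.map (D (Sum.inl j)) = uniformSphere (EuclideanSpace ℝ (Fin M))
  inlier_law : ∀ i, P.map (D (Sum.inr i)) = uniformSphereIn U

section Deterministic

/-- `‖Dᵀ c‖₁` for the matrix with columns `D k`. -/
noncomputable def l1Corr {M : ℕ} {κ : Type*} [Fintype κ] (D : κ → EuclideanSpace ℝ (Fin M))
    (c : EuclideanSpace ℝ (Fin M)) : ℝ :=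
  ∑ k, |inner ℝ (D k) c|

/-- `c` is an optimal point of `min ‖Dᵀ c‖₁` subject to `cᵀ d = 1`. -/
def IsOptimalDirection {M : ℕ} {κ : Type*} [Fintype κ] (D : κ → EuclideanSpace ℝ (Fin M))
    (d c : EuclideanSpace ℝ (Fin M)) : Prop :=
  inner ℝ d c = 1 ∧ ∀ c' : EuclideanSpace ℝ (Fin M), inner ℝ d c' = 1 → l1Corr D c ≤ l1Corr D c'

/-- Optimal directions exist for every nonzero column. -/
theorem exists_isOptimalDirection {M : ℕ} {κ : Type*} [Fintype κ]
    (D : κ → EuclideanSpace ℝ (Fin M)) (k : κ) (hk : D k ≠ 0) :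
    ∃ c, IsOptimalDirection D (D k) c := by
  let T : EuclideanSpace ℝ (Fin M) →ₗ[ℝ] PiLp 1 (fun _ : κ => ℝ) :=
    (WithLp.linearEquiv 1 ℝ (κ → ℝ)).symm.toLinearMap ∘ₗ
      LinearMap.pi fun k => (innerₗ (EuclideanSpace ℝ (Fin M)) (D k))
  have hT : ∀ c k, T c k = inner ℝ (D k) c := fun c k => rfl
  have hnorm : ∀ c, ‖T c‖ = l1Corr D c := by
    intro c
    rw [PiLp.norm_eq_of_nat 1 (by simp)]
    simp [l1Corr, hT]
  let S : Set (PiLp 1 (fun _ : κ => ℝ)) :=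
    (LinearMap.range T : Set (PiLp 1 (fun _ : κ => ℝ))) ∩ {y | y k = 1}
  have hS : IsClosed S := by
    refine (Submodule.closed_of_finiteDimensional _).inter ?_
    exact isClosed_eq (by fun_prop) continuous_const
  have hne : S.Nonempty := by
    refine ⟨T ((‖D k‖ ^ 2)⁻¹ • D k), ⟨_, rfl⟩, ?_⟩
    have : ‖D k‖ ≠ 0 := norm_ne_zero_iff.mpr hk
    simp only [Set.mem_ofPred_eq, hT, inner_smul_right, real_inner_self_eq_norm_sq]
    field_simp
  obtain ⟨y, ⟨⟨c, rfl⟩, hy⟩, hmin⟩ := hS.exists_infDist_eq_dist hne 0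
  refine ⟨c, hy, fun c' hc' => ?_⟩
  rw [← hnorm, ← hnorm, ← dist_zero_left, ← dist_zero_left, ← hmin]
  exact Metric.infDist_le_dist_of_mem ⟨⟨c', rfl⟩, hc'⟩

/-- The Innovation Value `1 / ‖Dᵀ c‖₁` computed with the optimal direction `c`. -/
noncomputable def innovationValue {M : ℕ} {κ : Type*} [Fintype κ]
    (D : κ → EuclideanSpace ℝ (Fin M)) (c : EuclideanSpace ℝ (Fin M)) : ℝ :=
  1 / l1Corr D c

/-- `χ`: the largest Euclidean norm of an optimal direction that belongs to an outlier. -/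
noncomputable def chi {M nₒ nᵢ : ℕ} (C : Fin nₒ ⊕ Fin nᵢ → EuclideanSpace ℝ (Fin M)) : ℝ :=
  ⨆ j : Fin nₒ, ‖C (Sum.inl j)‖

/-- `n_z'`: the largest number of outliers orthogonal to one optimal direction that belongs to
an outlier. -/
noncomputable def nz {M nₒ nᵢ : ℕ} (D C : Fin nₒ ⊕ Fin nᵢ → EuclideanSpace ℝ (Fin M)) : ℕ :=
  Finset.univ.sup fun j : Fin nₒ =>
    Nat.card {k : Fin nₒ // inner ℝ (C (Sum.inl j)) (D (Sum.inl k)) = 0}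

/-- `S` is a possible outcome of the selection step of the algorithm: it consists of columns
with the smallest values of `x` and these columns span an `r`-dimensional subspace. -/
def IsSelection {M : ℕ} {κ : Type*} (D : κ → EuclideanSpace ℝ (Fin M)) (x : κ → ℝ) (r : ℕ)
    (S : Set κ) : Prop :=
  (∀ k ∈ S, ∀ l ∉ S, x k ≤ x l) ∧ Module.finrank ℝ (Submodule.span ℝ (D '' S)) = r

/-- `U` is recovered exactly: the selection step can be carried out, and the column space of
every basis matrix that it can produce (whichever way ties are broken) is `U`. -/
def RecoversExactly {M : ℕ} {κ : Type*} (D : κ → EuclideanSpace ℝ (Fin M)) (x : κ → ℝ) (r : ℕ)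
    (U : Submodule ℝ (EuclideanSpace ℝ (Fin M))) : Prop :=
  (∃ S, IsSelection D x r S) ∧ ∀ S, IsSelection D x r S → Submodule.span ℝ (D '' S) = U

end Deterministic

section Constants

/-- `𝒜`. -/
noncomputable def calA (nᵢ r : ℕ) (δ : ℝ) : ℝ :=
  √(1 / (2 * Real.pi)) * (nᵢ / √r) - √nᵢ - √(nᵢ * Real.log (1 / δ) / (2 * r - 2))

/-- `c_δ`. -/
noncomputable def cDelta (M r nₒ : ℕ) (δ : ℝ) : ℝ :=
  (3 * max 1 (max √(8 * M * Real.pi / ((M - 1) * r))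
    √(8 * M * Real.log (nₒ / δ) / ((M - 1) * r)))) ^ 2

/-- `c_δ''`. -/
noncomputable def cDelta'' (M nₒ : ℕ) (δ : ℝ) : ℝ :=
  (3 * max 1 (max √(8 * M * Real.pi / (M - 1))
    √(16 * M * Real.log (nₒ / δ) / (M - 1)))) ^ 2

/-- `η_δ`. -/
noncomputable def etaDelta (M nₒ : ℕ) (δ : ℝ) : ℝ :=
  max (4 / 3 * Real.log (2 * M / δ)) √(4 * (nₒ / M) * Real.log (2 * M / δ))

/-- The first sufficient condition, `z` being `n_z'`. -/
def Cond1 (M r nᵢ nₒ : ℕ) (δ : ℝ) (z : ℕ) : Prop :=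
  calA nᵢ r δ >
    2 * z * √(cDelta M r nₒ δ * r / M)
      + 2 * √(nₒ * cDelta M r nₒ δ * r * Real.log (nₒ / δ) / M)

/-- The second sufficient condition, `z` being `n_z'`. -/
def Cond2 (M r nᵢ nₒ : ℕ) (δ : ℝ) (z : ℕ) : Prop :=
  calA nᵢ r δ >
    (nₒ / M + √(4 * nₒ / M) + √(2 * nₒ * Real.log (1 / δ) / ((M - 1) * M))
        + √(nₒ * cDelta'' M nₒ δ * Real.log (nₒ / δ) / M ^ 2)
        + z * √(cDelta'' M nₒ δ / M ^ 2)
        + √(nₒ * Real.log (nₒ / δ) / M ^ 2 + etaDelta M nₒ δ * Real.log (nₒ / δ) / M))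
      * √(4 * M * cDelta M r nₒ δ / (M - cDelta M r nₒ δ * r))

/-- The third sufficient condition, `χ` being the largest norm of an optimal direction of an
outlier. -/
def Cond3 (M r nᵢ nₒ : ℕ) (δ χ : ℝ) : Prop :=
  calA nᵢ r δ >
    χ * (nₒ / √M) + 2 * √nₒ * (1 + √χ) + 2 * √(2 * χ * nₒ * Real.log (1 / δ) / (M - 1))

end Constants

end InnovationSearch

/-! Since Innovation Values are reciprocals of optimal ℓ¹ costs, it suffices that every vector
feasible for an inlier costs more than one suitable vector feasible for an outlier. If `c` is
feasible for an inlier, its projection to `U` has norm at least 1, so its cost is at least the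
minimum over unit `u ∈ U` of the sum of `|⟨a i, u⟩|` over the inliers (`le_l1Corr_inlier`). For an
outlier, the rescaled component orthogonal to `U` is feasible and annihilates all inliers, so only
the correlations with the other outliers count (`l1Corr_outlier_le`).

The random input is collected in `IsGoodData`, which does not mention the optimal points; hence one
event serves all their choices. It fails with probability at most `4 * δ`. The uniform bound over
the unit sphere of `U` comes from smoothing instead of a net. With `f v = ∑ |⟨a i, v⟩|`,
subadditivity bounds `exp (-c f u)`, for any unit `u`, by an integral of `exp (-c f)` over a shell,
up to volume factors; that integral does not depend on `u` and Markov's inequality controls it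
(`measure_exists_sum_abs_inner_lt_le`). The outlier bounds are Chernoff bounds for squared
coordinates of a uniform point, obtained from Gaussian integrals by polar coordinates and Jensen's
inequality (`integral_exp_sum_sq_uniformSphere_le`).

Finally, `c_δ r < M` forces `9 r ≤ M` and `72 log (nₒ / δ) ≤ M`, while `χ ≥ 1` turns the third
condition into `𝒜 > nₒ / √M + 4 √nₒ`. Numerically, inlier costs are at least `1.21 𝒜`
(`calA_le_of_sum_ge`) and outlier costs are below `1.21 (nₒ / √M + 4 √nₒ)` (`outlier_bound_lt`). -/

namespace InnovationSearch

/-! ### Gaussian integrals on a Euclidean space. -/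

section Gaussian

variable {F : Type*} [NormedAddCommGroup F] [InnerProductSpace ℝ F] [FiniteDimensional ℝ F]
  [MeasurableSpace F] [BorelSpace F] {ι : Type*} [Fintype ι]

theorem measurePreserving_coordinates (b : OrthonormalBasis ι ℝ F) :
    MeasurePreserving (fun (x : F) (i : ι) => inner ℝ (b i) x) volume volume := by
  have h := (PiLp.volume_preserving_ofLp ι).comp b.measurePreserving_repr
  convert h using 1
  · rfl
  · funext x i
    simp [OrthonormalBasis.repr_apply_apply]

omit [FiniteDimensional ℝ F] in
theorem measurableEmbedding_coordinates (b : OrthonormalBasis ι ℝ F) :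
    MeasurableEmbedding (fun (x : F) (i : ι) => inner ℝ (b i) x) := by
  have h := (MeasurableEquiv.toLp 2 (ι → ℝ)).symm.measurableEmbedding.comp
    b.measurableEquiv.measurableEmbedding
  convert h using 1
  funext x i
  simp [OrthonormalBasis.repr_apply_apply, OrthonormalBasis.measurableEquiv]

theorem integral_prod_inner (b : OrthonormalBasis ι ℝ F) (f : ι → ℝ → ℝ) :
    ∫ x : F, ∏ i, f i (inner ℝ (b i) x) = ∏ i, ∫ t, f i t := by
  rw [← integral_fintype_prod_volume_eq_prod]
  exact (measurePreserving_coordinates b).integral_comp (measurableEmbedding_coordinates b)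
    (fun y : ι → ℝ => ∏ i, f i (y i))

theorem integrable_prod_inner (b : OrthonormalBasis ι ℝ F) (f : ι → ℝ → ℝ)
    (hf : ∀ i, Integrable (f i)) :
    Integrable (fun x : F => ∏ i, f i (inner ℝ (b i) x)) :=
  ((measurePreserving_coordinates b).integrable_comp_emb (measurableEmbedding_coordinates b)
    (g := fun y : ι → ℝ => ∏ i, f i (y i))).2 (Integrable.fintype_prod hf)

omit [FiniteDimensional ℝ F] [MeasurableSpace F] [BorelSpace F] in
theorem exp_neg_norm_sq_div_two_eq_prod (b : OrthonormalBasis ι ℝ F) (x : F) :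
    Real.exp (-‖x‖ ^ 2 / 2) = ∏ i, Real.exp (-(1 / 2) * inner ℝ (b i) x ^ 2) := by
  rw [← Real.exp_sum, ← Finset.mul_sum, b.sum_sq_inner_right x]
  ring_nf

theorem integrable_gaussian :
    Integrable (fun x : F => Real.exp (-‖x‖ ^ 2 / 2)) := by
  simp_rw [exp_neg_norm_sq_div_two_eq_prod (stdOrthonormalBasis ℝ F)]
  exact integrable_prod_inner _ (fun _ t => Real.exp (-(1 / 2) * t ^ 2))
    fun i => integrable_exp_neg_mul_sq (by norm_num)

theorem integral_gaussian_eq :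
    ∫ x : F, Real.exp (-‖x‖ ^ 2 / 2) = √(2 * Real.pi) ^ Module.finrank ℝ F := by
  simp_rw [exp_neg_norm_sq_div_two_eq_prod (stdOrthonormalBasis ℝ F)]
  rw [integral_prod_inner _ (fun _ t => Real.exp (-(1 / 2) * t ^ 2))]
  rw [integral_gaussian]
  simp
  ring_nf

theorem integral_gaussian_pos : 0 < ∫ x : F, Real.exp (-‖x‖ ^ 2 / 2) := by
  rw [integral_gaussian_eq]
  have := Real.pi_pos
  positivity

/-- One-dimensional marginals of the Gaussian weight. -/
theorem integral_comp_inner_mul_gaussian [DecidableEq ι] (b : OrthonormalBasis ι ℝ F) (i : ι)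
    (g : ℝ → ℝ) :
    ∫ x : F, g (inner ℝ (b i) x) * Real.exp (-‖x‖ ^ 2 / 2) =
      (∫ t, g t * Real.exp (-(1 / 2) * t ^ 2)) / √(2 * Real.pi) *
        ∫ x : F, Real.exp (-‖x‖ ^ 2 / 2) := by
  have key : ∀ x : F, g (inner ℝ (b i) x) * Real.exp (-‖x‖ ^ 2 / 2) =
      ∏ j, (if j = i then fun t => g t * Real.exp (-(1 / 2) * t ^ 2)
        else fun t => Real.exp (-(1 / 2) * t ^ 2)) (inner ℝ (b j) x) := by
    intro x
    rw [exp_neg_norm_sq_div_two_eq_prod b, ← Finset.mul_prod_erase _ _ (Finset.mem_univ i),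
      ← Finset.mul_prod_erase _ _ (Finset.mem_univ i), if_pos rfl, ← mul_assoc]
    congr 1
    refine Finset.prod_congr rfl fun j hj => ?_
    rw [if_neg (Finset.ne_of_mem_erase hj)]
  have hZ : ∫ x : F, Real.exp (-‖x‖ ^ 2 / 2) =
      ∏ j : ι, ∫ t, Real.exp (-(1 / 2) * t ^ 2) := by
    rw [← integral_prod_inner b]
    simp_rw [exp_neg_norm_sq_div_two_eq_prod b]
  have h1 : ∫ t, Real.exp (-(1 / 2) * t ^ 2) = √(2 * Real.pi) := by
    rw [integral_gaussian]; ring_nf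
  simp_rw [key]
  rw [integral_prod_inner b, hZ, ← Finset.mul_prod_erase _ _ (Finset.mem_univ i),
    ← Finset.mul_prod_erase Finset.univ (fun _ => ∫ t, Real.exp (-(1 / 2) * t ^ 2))
      (Finset.mem_univ i), if_pos rfl, h1]
  have : √(2 * Real.pi) ≠ 0 := by have := Real.pi_pos; positivity
  rw [← mul_assoc, div_mul_cancel₀ _ this]
  congr 1
  refine Finset.prod_congr rfl fun j hj => ?_
  rw [if_neg (Finset.ne_of_mem_erase hj), h1]

theorem integrable_comp_inner_mul_gaussian [DecidableEq ι] (b : OrthonormalBasis ι ℝ F) (i : ι)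
    (g : ℝ → ℝ) (hg : Integrable (fun t => g t * Real.exp (-(1 / 2) * t ^ 2))) :
    Integrable (fun x : F => g (inner ℝ (b i) x) * Real.exp (-‖x‖ ^ 2 / 2)) := by
  have key : ∀ x : F, g (inner ℝ (b i) x) * Real.exp (-‖x‖ ^ 2 / 2) =
      ∏ j, (if j = i then fun t => g t * Real.exp (-(1 / 2) * t ^ 2)
        else fun t => Real.exp (-(1 / 2) * t ^ 2)) (inner ℝ (b j) x) := by
    intro x
    rw [exp_neg_norm_sq_div_two_eq_prod b, ← Finset.mul_prod_erase _ _ (Finset.mem_univ i),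
      ← Finset.mul_prod_erase _ _ (Finset.mem_univ i), if_pos rfl, ← mul_assoc]
    congr 1
    refine Finset.prod_congr rfl fun j hj => ?_
    rw [if_neg (Finset.ne_of_mem_erase hj)]
  simp_rw [key]
  refine integrable_prod_inner b _ fun j => ?_
  split_ifs
  · exact hg
  · exact integrable_exp_neg_mul_sq (by norm_num)

omit [MeasurableSpace F] [BorelSpace F] in
/-- Every unit vector belongs to an orthonormal basis. -/
theorem exists_orthonormalBasis_of_norm_eq_one {e : F} (he : ‖e‖ = 1) :
    ∃ (b : OrthonormalBasis (Fin (Module.finrank ℝ F)) ℝ F) (i : Fin (Module.finrank ℝ F)),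
      b i = e := by
  have hne : e ≠ 0 := by rintro rfl; simp at he
  have : Nontrivial F := ⟨⟨e, 0, hne⟩⟩
  have hpos : 0 < Module.finrank ℝ F := Module.finrank_pos
  obtain ⟨b, hb⟩ := Orthonormal.exists_orthonormalBasis_extension_of_card_eq (𝕜 := ℝ) (E := F)
    (ι := Fin (Module.finrank ℝ F)) (by simp) (v := fun _ => e) (s := {⟨0, hpos⟩}) (by
      constructor
      · simp [he]
      · intro i j hij
        exact absurd (Subsingleton.elim i j) hij)
  exact ⟨b, ⟨0, hpos⟩, hb _ rfl⟩

theorem integral_sq_mul_exp_neg_half_sq :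
    ∫ t : ℝ, t ^ 2 * Real.exp (-(1 / 2) * t ^ 2) = √(2 * Real.pi) := by
  have h := integral_comp_abs (f := fun t : ℝ => t ^ 2 * Real.exp (-(1 / 2) * t ^ 2))
  simp only [sq_abs] at h
  rw [h]
  have h2 := integral_rpow_mul_exp_neg_mul_rpow (p := 2) (q := 2) (b := 1 / 2) (by norm_num)
    (by norm_num) (by norm_num)
  norm_num [-neg_mul] at h2
  rw [show (-(1 / 2) : ℝ) = -(1 / 2 : ℝ) from rfl]
  have h3 : (∫ t in Set.Ioi (0 : ℝ), t ^ 2 * Real.exp (-(1 / 2) * t ^ 2)) = √2 * √Real.pi / 2 := by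
    rw [h2, show (3 / 2 : ℝ) = 1 / 2 + 1 by norm_num, Real.Gamma_add_one (by norm_num),
      Real.Gamma_one_half_eq, show (-(1 / 2 + 1) : ℝ) = -(3 / 2) by norm_num,
      Real.rpow_neg (by norm_num), ← Real.inv_rpow (by norm_num),
      show (3 / 2 : ℝ) = 1 + 1 / 2 by norm_num, Real.rpow_add (by norm_num), ← Real.sqrt_eq_rpow]
    norm_num
    ring
  rw [h3, Real.sqrt_mul (by norm_num)]
  ring

theorem integrable_sq_mul_exp_neg_half_sq :
    Integrable fun t : ℝ => t ^ 2 * Real.exp (-(1 / 2) * t ^ 2) := by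
  have := integrable_rpow_mul_exp_neg_mul_sq (b := 1 / 2) (by norm_num) (s := 2) (by norm_num)
  simpa using this

theorem integral_abs_mul_exp_neg_half_sq :
    ∫ t : ℝ, |t| * Real.exp (-(1 / 2) * t ^ 2) = 2 := by
  have h := integral_comp_abs (f := fun t : ℝ => t * Real.exp (-(1 / 2) * t ^ 2))
  simp only [sq_abs] at h
  rw [h]
  have h2 := integral_rpow_mul_exp_neg_mul_rpow (p := 2) (q := 1) (b := 1 / 2) (by norm_num)
    (by norm_num) (by norm_num)
  norm_num [-neg_mul, Real.rpow_neg] at h2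
  rw [h2]
  norm_num

theorem integral_inner_sq_mul_gaussian {e : F} (he : ‖e‖ = 1) :
    ∫ x : F, inner ℝ e x ^ 2 * Real.exp (-‖x‖ ^ 2 / 2) = ∫ x : F, Real.exp (-‖x‖ ^ 2 / 2) := by
  obtain ⟨b, i, rfl⟩ := exists_orthonormalBasis_of_norm_eq_one he
  rw [integral_comp_inner_mul_gaussian b i (fun t => t ^ 2), integral_sq_mul_exp_neg_half_sq,
    div_self, one_mul]
  have := Real.pi_pos; positivity

theorem integral_abs_inner_mul_gaussian {e : F} (he : ‖e‖ = 1) :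
    ∫ x : F, |inner ℝ e x| * Real.exp (-‖x‖ ^ 2 / 2) =
      √(2 / Real.pi) * ∫ x : F, Real.exp (-‖x‖ ^ 2 / 2) := by
  obtain ⟨b, i, rfl⟩ := exists_orthonormalBasis_of_norm_eq_one he
  rw [integral_comp_inner_mul_gaussian b i (fun t => |t|), integral_abs_mul_exp_neg_half_sq]
  congr 1
  have := Real.pi_pos
  rw [div_eq_iff (by positivity), ← Real.sqrt_mul (by positivity)]
  rw [show 2 / Real.pi * (2 * Real.pi) = 2 ^ 2 by field_simp]
  simp

theorem integrable_norm_sq_mul_gaussian :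
    Integrable (fun x : F => ‖x‖ ^ 2 * Real.exp (-‖x‖ ^ 2 / 2)) := by
  have : ∀ x : F, ‖x‖ ^ 2 * Real.exp (-‖x‖ ^ 2 / 2) =
      ∑ i, inner ℝ (stdOrthonormalBasis ℝ F i) x ^ 2 * Real.exp (-‖x‖ ^ 2 / 2) := by
    intro x
    rw [← Finset.sum_mul, (stdOrthonormalBasis ℝ F).sum_sq_inner_right x]
  simp_rw [this]
  exact integrable_finsetSum _ fun i _ =>
    integrable_comp_inner_mul_gaussian _ i _ integrable_sq_mul_exp_neg_half_sq

theorem integral_norm_sq_mul_gaussian :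
    ∫ x : F, ‖x‖ ^ 2 * Real.exp (-‖x‖ ^ 2 / 2) =
      Module.finrank ℝ F * ∫ x : F, Real.exp (-‖x‖ ^ 2 / 2) := by
  have : ∀ x : F, ‖x‖ ^ 2 * Real.exp (-‖x‖ ^ 2 / 2) =
      ∑ i, inner ℝ (stdOrthonormalBasis ℝ F i) x ^ 2 * Real.exp (-‖x‖ ^ 2 / 2) := by
    intro x
    rw [← Finset.sum_mul, (stdOrthonormalBasis ℝ F).sum_sq_inner_right x]
  simp_rw [this]
  rw [integral_finsetSum _ fun i _ =>
    integrable_comp_inner_mul_gaussian _ i _ integrable_sq_mul_exp_neg_half_sq]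
  simp [integral_inner_sq_mul_gaussian]

theorem integrable_norm_mul_gaussian :
    Integrable (fun x : F => ‖x‖ * Real.exp (-‖x‖ ^ 2 / 2)) := by
  refine (integrable_gaussian.add integrable_norm_sq_mul_gaussian).mono' (by fun_prop) ?_
  refine Filter.Eventually.of_forall fun x => ?_
  rw [norm_mul, norm_norm, Real.norm_eq_abs, Real.abs_exp, Pi.add_apply]
  have h1 : ‖x‖ ≤ 1 + ‖x‖ ^ 2 := by nlinarith [sq_nonneg (‖x‖ - 1)]
  linarith [mul_le_mul_of_nonneg_right h1 (Real.exp_pos (-‖x‖ ^ 2 / 2)).le]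

/-- The AM–GM bound `‖x‖ ≤ ‖x‖² / (2√d) + √d / 2` reduces this to the second moment, which is known
exactly. -/
theorem integral_norm_mul_gaussian_le [Nontrivial F] :
    ∫ x : F, ‖x‖ * Real.exp (-‖x‖ ^ 2 / 2) ≤
      √(Module.finrank ℝ F) * ∫ x : F, Real.exp (-‖x‖ ^ 2 / 2) := by
  have hd : (0 : ℝ) < Module.finrank ℝ F := by exact_mod_cast Module.finrank_pos (R := ℝ) (M := F)
  set d : ℝ := (Module.finrank ℝ F : ℝ) with hdd
  have hs : 0 < √d := Real.sqrt_pos.2 hd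
  have hss : √d * √d = d := Real.mul_self_sqrt hd.le
  calc ∫ x : F, ‖x‖ * Real.exp (-‖x‖ ^ 2 / 2)
      ≤ ∫ x : F, ((2 * √d)⁻¹ * (‖x‖ ^ 2 * Real.exp (-‖x‖ ^ 2 / 2)) +
          √d / 2 * Real.exp (-‖x‖ ^ 2 / 2)) := by
        refine integral_mono integrable_norm_mul_gaussian
          ((integrable_norm_sq_mul_gaussian.const_mul _).add (integrable_gaussian.const_mul _)) ?_
        intro x
        have h1 : ‖x‖ ≤ (2 * √d)⁻¹ * ‖x‖ ^ 2 + √d / 2 := by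
          rw [← sub_nonneg]
          have : (2 * √d)⁻¹ * ‖x‖ ^ 2 + √d / 2 - ‖x‖ = (2 * √d)⁻¹ * (‖x‖ - √d) ^ 2 := by
            field_simp; ring
          rw [this]; positivity
        have := mul_le_mul_of_nonneg_right h1 (Real.exp_pos (-‖x‖ ^ 2 / 2)).le
        calc _ ≤ _ := this
          _ = _ := by ring
    _ = √d * ∫ x : F, Real.exp (-‖x‖ ^ 2 / 2) := by
        rw [integral_add (integrable_norm_sq_mul_gaussian.const_mul _)
          (integrable_gaussian.const_mul _), integral_const_mul, integral_const_mul,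
          integral_norm_sq_mul_gaussian, ← hdd]
        have : (2 * √d)⁻¹ * d = √d / 2 := by
          rw [inv_mul_eq_iff_eq_mul₀ (by positivity)]; linarith
        rw [← mul_assoc, this]; ring

end Gaussian

/-! ### Moments of the uniform distribution on the sphere, by polar coordinates. -/

section Sphere

variable {F : Type*} [NormedAddCommGroup F] [InnerProductSpace ℝ F] [FiniteDimensional ℝ F]
  [MeasurableSpace F] [BorelSpace F]

instance isProbabilityMeasure_uniformSphere [Nontrivial F] :
    IsProbabilityMeasure (uniformSphere F) := by
  constructor
  rw [uniformSphere, Measure.smul_apply, Measure.map_apply measurable_subtype_coe .univ,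
    Set.preimage_univ, smul_eq_mul]
  refine ENNReal.inv_mul_cancel ?_ (measure_ne_top _ _)
  rw [Ne, Measure.measure_univ_eq_zero]
  exact Measure.toSphere_ne_zero _

theorem ae_norm_eq_one_uniformSphere : ∀ᵐ x ∂(uniformSphere F), ‖x‖ = 1 := by
  rw [uniformSphere]
  refine Measure.ae_smul_measure ?_ _
  rw [ae_map_iff (by fun_prop) (measurableSet_eq_fun (by fun_prop) (by fun_prop))]
  exact Filter.Eventually.of_forall fun x => by simp

theorem integral_uniformSphere (G : F → ℝ) :
    ∫ x, G x ∂(uniformSphere F) =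
      ((volume : Measure F).toSphere.real Set.univ)⁻¹ *
        ∫ x : Metric.sphere (0 : F) 1, G x ∂(volume : Measure F).toSphere := by
  rw [uniformSphere, integral_smul_measure, (MeasurableEmbedding.subtype_coe
    Metric.isClosed_sphere.measurableSet).integral_map, ENNReal.toReal_inv, smul_eq_mul]
  rfl

/-- Polar coordinates for a product of an angular and a radial function. -/
theorem integral_angular_mul_radial [Nontrivial F] (G : F → ℝ) (ρ : ℝ → ℝ) :
    ∫ x : F, G (‖x‖⁻¹ • x) * ρ ‖x‖ =
      (∫ x, G x ∂(uniformSphere F)) * ∫ x : F, ρ ‖x‖ := by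
  have polar : ∀ H : F → ℝ, ∫ x : F, H (‖x‖⁻¹ • x) * ρ ‖x‖ =
      (∫ x : Metric.sphere (0 : F) 1, H x ∂(volume : Measure F).toSphere) *
        ∫ t : Set.Ioi (0 : ℝ), ρ t ∂(Measure.volumeIoiPow (Module.finrank ℝ F - 1)) := by
    intro H
    rw [← integral_prod_mul (fun x : Metric.sphere (0 : F) 1 => H x)
      (fun t : Set.Ioi (0 : ℝ) => ρ t)]
    rw [← (Measure.measurePreserving_homeomorphUnitSphereProd (volume : Measure F)).integral_comp
      (Homeomorph.measurableEmbedding _)]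
    have h0 := integral_subtype_comap (μ := volume) (measurableSet_singleton (0 : F)).compl
      (fun x => H (‖x‖⁻¹ • x) * ρ ‖x‖)
    rw [restrict_compl_singleton] at h0
    rw [← h0]
    simp
  -- The constant angular function isolates the radial factor, so dividing by the surface area
  -- produces the normalized measure.
  have h1 := polar (fun _ => 1)
  simp only [one_mul, integral_const, smul_eq_mul, mul_one] at h1
  rw [polar, h1, integral_uniformSphere]
  have : (volume : Measure F).toSphere.real Set.univ ≠ 0 := by
    rw [Measure.toSphere_real_apply_univ]
    have h2 : Module.finrank ℝ F ≠ 0 := Module.finrank_pos.ne'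
    have h3 : (volume : Measure F).real (Metric.ball 0 1) ≠ 0 := by
      rw [measureReal_def, ENNReal.toReal_ne_zero]
      exact ⟨(Metric.measure_ball_pos _ _ one_pos).ne', measure_ball_lt_top.ne⟩
    positivity
  field_simp

theorem integral_inner_sq_uniformSphere [Nontrivial F] {e : F} (he : ‖e‖ = 1) :
    ∫ x, inner ℝ e x ^ 2 ∂(uniformSphere F) = (Module.finrank ℝ F : ℝ)⁻¹ := by
  have h := integral_angular_mul_radial (fun x : F => inner ℝ e x ^ 2)
    (fun t => t ^ 2 * Real.exp (-t ^ 2 / 2))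
  have h1 : ∀ x : F, inner ℝ e (‖x‖⁻¹ • x) ^ 2 * (‖x‖ ^ 2 * Real.exp (-‖x‖ ^ 2 / 2)) =
      inner ℝ e x ^ 2 * Real.exp (-‖x‖ ^ 2 / 2) := by
    intro x
    rcases eq_or_ne x 0 with rfl | hx
    · simp
    · rw [inner_smul_right]
      have := norm_ne_zero_iff.2 hx
      field_simp
  simp only [h1] at h
  rw [integral_inner_sq_mul_gaussian he, integral_norm_sq_mul_gaussian] at h
  have hZ := (integral_gaussian_pos (F := F)).ne'
  have h2 : (Module.finrank ℝ F : ℝ) ≠ 0 := by exact_mod_cast (Module.finrank_pos (R := ℝ)).ne'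
  field_simp
  rw [← mul_assoc] at h
  exact (mul_right_cancel₀ hZ (by rw [one_mul]; exact h)).symm

/-- A Gaussian vector is its norm times an independent uniform direction, so `E|⟨e, g⟩| = √(2/π)`
factors; dividing by `E‖g‖ ≤ √d` gives the bound. -/
theorem le_integral_abs_inner_uniformSphere [Nontrivial F] {e : F} (he : ‖e‖ = 1) :
    √(2 / Real.pi) / √(Module.finrank ℝ F) ≤ ∫ x, |inner ℝ e x| ∂(uniformSphere F) := by
  have h := integral_angular_mul_radial (fun x : F => |inner ℝ e x|)
    (fun t => t * Real.exp (-t ^ 2 / 2))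
  have h1 : ∀ x : F, |inner ℝ e (‖x‖⁻¹ • x)| * (‖x‖ * Real.exp (-‖x‖ ^ 2 / 2)) =
      |inner ℝ e x| * Real.exp (-‖x‖ ^ 2 / 2) := by
    intro x
    rcases eq_or_ne x 0 with rfl | hx
    · simp
    · rw [inner_smul_right, abs_mul, abs_of_nonneg (by positivity)]
      have := norm_ne_zero_iff.2 hx
      field_simp
  simp only [h1] at h
  rw [integral_abs_inner_mul_gaussian he] at h
  have hZ := integral_gaussian_pos (F := F)
  have h2 : (0 : ℝ) < Module.finrank ℝ F := by exact_mod_cast Module.finrank_pos (R := ℝ) (M := F)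
  have h3 : 0 ≤ ∫ x, |inner ℝ e x| ∂(uniformSphere F) :=
    integral_nonneg fun x => abs_nonneg _
  rw [div_le_iff₀ (Real.sqrt_pos.2 h2)]
  refine le_of_mul_le_mul_right ?_ hZ
  rw [h, mul_assoc]
  exact mul_le_mul_of_nonneg_left integral_norm_mul_gaussian_le h3

/-- The angular factor is exactly `1 / d`; the radial factor `‖x‖²` is bounded crudely by `s²`. -/
theorem integral_ball_inner_sq_le [Nontrivial F] {e : F} (he : ‖e‖ = 1) (s : ℝ) :
    ∫ x in Metric.ball (0 : F) s, inner ℝ e x ^ 2 ≤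
      s ^ 2 / Module.finrank ℝ F * (volume : Measure F).real (Metric.ball 0 s) := by
  have h := integral_angular_mul_radial (fun x : F => inner ℝ e x ^ 2)
    (fun t => (Set.Iio s).indicator (fun t => t ^ 2) t)
  have h1 : ∀ x : F, inner ℝ e (‖x‖⁻¹ • x) ^ 2 * (Set.Iio s).indicator (fun t => t ^ 2) ‖x‖ =
      (Metric.ball (0 : F) s).indicator (fun x => inner ℝ e x ^ 2) x := by
    intro x
    by_cases hxs : ‖x‖ < s
    · rw [Set.indicator_of_mem (by simpa using hxs), Set.indicator_of_mem (by simpa using hxs)]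
      rcases eq_or_ne x 0 with rfl | hx
      · simp
      · rw [inner_smul_right]
        have := norm_ne_zero_iff.2 hx
        field_simp
    · rw [Set.indicator_of_notMem (by simpa using hxs), Set.indicator_of_notMem (by simpa using hxs)]
      simp
  simp only [h1] at h
  rw [integral_indicator measurableSet_ball, integral_inner_sq_uniformSphere he] at h
  rw [h, div_eq_inv_mul, mul_assoc]
  refine mul_le_mul_of_nonneg_left ?_ (by positivity)
  calc ∫ x : F, (Set.Iio s).indicator (fun t => t ^ 2) ‖x‖
      ≤ ∫ x : F, (Metric.ball (0 : F) s).indicator (fun _ => s ^ 2) x := by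
        refine integral_mono_of_nonneg (Filter.Eventually.of_forall fun x => ?_)
          ((integrableOn_const (μ := volume) (s := Metric.ball (0 : F) s) (C := s ^ 2)
            measure_ball_lt_top.ne).integrable_indicator measurableSet_ball)
          (Filter.Eventually.of_forall fun x => ?_)
        · exact Set.indicator_nonneg (fun t _ => sq_nonneg t) _
        · by_cases hxs : ‖x‖ < s
          · simp only
            rw [Set.indicator_of_mem (by simpa using hxs), Set.indicator_of_mem (by simpa using hxs)]
            exact pow_le_pow_left₀ (norm_nonneg x) hxs.le 2
          · simp only
            rw [Set.indicator_of_notMem (by simpa using hxs),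
              Set.indicator_of_notMem (by simpa using hxs)]
    _ = s ^ 2 * (volume : Measure F).real (Metric.ball 0 s) := by
        rw [integral_indicator measurableSet_ball]
        simp [mul_comm]

/-- The exponential moment of the squared length of some coordinates of a uniform point. -/
theorem integral_exp_sum_sq_uniformSphere_le [Nontrivial F] {ι : Type*} [Fintype ι]
    (b : OrthonormalBasis ι ℝ F) (s : Finset ι) {α : ℝ} (hα0 : 0 ≤ α) (hα1 : α < 1) :
    ∫ x, Real.exp (α * Module.finrank ℝ F / 2 * ∑ i ∈ s, inner ℝ (b i) x ^ 2) ∂(uniformSphere F) ≤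
      (√(1 - α))⁻¹ ^ s.card := by
  classical
  set d : ℝ := (Module.finrank ℝ F : ℝ) with hd
  have hdpos : 0 < d := by rw [hd]; exact_mod_cast Module.finrank_pos (R := ℝ) (M := F)
  set a : ℝ := α * d / 2 with ha
  have ha0 : 0 ≤ a := by positivity
  set p : F → ℝ := fun x => ∑ i ∈ s, inner ℝ (b i) x ^ 2 with hp
  have hp0 : ∀ x, 0 ≤ p x := fun x => Finset.sum_nonneg fun i _ => sq_nonneg _
  have hp1 : ∀ x, p x ≤ ‖x‖ ^ 2 := fun x => by
    rw [← b.sum_sq_inner_right x]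
    exact Finset.sum_le_univ_sum_of_nonneg fun i => sq_nonneg _
  have hpm : Measurable p := by fun_prop
  have hps : ∀ (t : ℝ) x, p (t • x) = t ^ 2 * p x := fun t x => by
    simp only [hp, inner_smul_right, mul_pow, Finset.mul_sum]
  have hpu : ∀ x : F, p (‖x‖⁻¹ • x) ≤ 1 := fun x => by
    refine (hp1 _).trans ?_
    rw [norm_smul, norm_inv, norm_norm]
    rcases eq_or_ne x 0 with rfl | hx
    · simp
    · rw [inv_mul_cancel₀ (norm_ne_zero_iff.2 hx), one_pow]
  have hprod : ∀ x : F, Real.exp (α / 2 * p x) * Real.exp (-‖x‖ ^ 2 / 2) =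
      ∏ i, (if i ∈ s then fun t : ℝ => Real.exp (-((1 - α) / 2) * t ^ 2)
        else fun t => Real.exp (-(1 / 2) * t ^ 2)) (inner ℝ (b i) x) := by
    intro x
    have : ∀ i, (if i ∈ s then fun t : ℝ => Real.exp (-((1 - α) / 2) * t ^ 2)
        else fun t => Real.exp (-(1 / 2) * t ^ 2)) (inner ℝ (b i) x) =
        Real.exp ((if i ∈ s then α / 2 * inner ℝ (b i) x ^ 2 else 0)
          + -(1 / 2) * inner ℝ (b i) x ^ 2) := by
      intro i
      split_ifs <;> simp only <;> congr 1 <;> ring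
    rw [Finset.prod_congr rfl fun i _ => this i, ← Real.exp_sum, Finset.sum_add_distrib,
      ← Finset.mul_sum, b.sum_sq_inner_right x, Finset.sum_ite_mem, Finset.univ_inter,
      ← Finset.mul_sum, Real.exp_add]
    congr 2
    ring
  have hint : ∀ i, Integrable (if i ∈ s then fun t : ℝ => Real.exp (-((1 - α) / 2) * t ^ 2)
        else fun t => Real.exp (-(1 / 2) * t ^ 2)) := by
    intro i
    split_ifs
    · exact integrable_exp_neg_mul_sq (by linarith)
    · exact integrable_exp_neg_mul_sq (by norm_num)
  have hpi := Real.pi_pos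
  have hval : ∫ x : F, Real.exp (α / 2 * p x) * Real.exp (-‖x‖ ^ 2 / 2) =
      (√(1 - α))⁻¹ ^ s.card * ∫ x : F, Real.exp (-‖x‖ ^ 2 / 2) := by
    simp_rw [hprod]
    rw [integral_prod_inner b]
    simp_rw [exp_neg_norm_sq_div_two_eq_prod b]
    rw [integral_prod_inner b (fun _ t => Real.exp (-(1 / 2) * t ^ 2))]
    have : ∀ i, ∫ t, (if i ∈ s then fun t : ℝ => Real.exp (-((1 - α) / 2) * t ^ 2)
        else fun t => Real.exp (-(1 / 2) * t ^ 2)) t = (if i ∈ s then (√(1 - α))⁻¹ else 1) *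
          ∫ t, Real.exp (-(1 / 2) * t ^ 2) := by
      intro i
      split_ifs
      · rw [integral_gaussian, integral_gaussian, ← Real.sqrt_inv, ← Real.sqrt_mul (by
          rw [inv_nonneg]; linarith)]
        congr 1
        have : 1 - α ≠ 0 := by linarith
        field_simp
      · rw [one_mul]
    rw [Finset.prod_congr rfl fun i _ => this i, Finset.prod_mul_distrib, Finset.prod_ite_mem,
      Finset.univ_inter, Finset.prod_const]
  have hI : Integrable fun x : F => Real.exp (α / 2 * p x) * Real.exp (-‖x‖ ^ 2 / 2) := by
    simp_rw [hprod]
    exact integrable_prod_inner b _ hint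
  -- the tangent line of `exp` at the conditional mean, integrated in polar coordinates
  let G₀ : F → ℝ := fun x => Real.exp (a * p x) * (1 - a * p x)
  let G₁ : F → ℝ := fun x => Real.exp (a * p x) * (a * p x)
  have hb : ∀ x : F, Real.exp (a * p (‖x‖⁻¹ • x)) ≤ Real.exp a := fun x =>
    Real.exp_le_exp.2 (by nlinarith [hpu x])
  have hG₁b : ∀ x : F, |G₁ (‖x‖⁻¹ • x)| ≤ Real.exp a * a := fun x => by
    rw [abs_of_nonneg (mul_nonneg (Real.exp_pos _).le (mul_nonneg ha0 (hp0 _)))]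
    exact mul_le_mul (hb x) (by nlinarith [hpu x]) (mul_nonneg ha0 (hp0 _)) (Real.exp_pos _).le
  have hG₀b : ∀ x : F, |G₀ (‖x‖⁻¹ • x)| ≤ Real.exp a * (1 + a) := fun x => by
    rw [abs_mul, Real.abs_exp]
    refine mul_le_mul (hb x) ?_ (abs_nonneg _) (Real.exp_pos _).le
    rw [abs_le]
    constructor <;> nlinarith [hpu x, mul_nonneg ha0 (hp0 (‖x‖⁻¹ • x))]
  have hI₀ : Integrable fun x : F => G₀ (‖x‖⁻¹ • x) * Real.exp (-‖x‖ ^ 2 / 2) :=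
    integrable_gaussian.bdd_mul (c := Real.exp a * (1 + a)) (by fun_prop)
      (Filter.Eventually.of_forall hG₀b)
  have hI₁ : Integrable fun x : F =>
      G₁ (‖x‖⁻¹ • x) * (‖x‖ ^ 2 * Real.exp (-‖x‖ ^ 2 / 2)) :=
    integrable_norm_sq_mul_gaussian.bdd_mul (c := Real.exp a * a) (by fun_prop)
      (Filter.Eventually.of_forall hG₁b)
  -- The tangent line is affine in `‖x‖²`, whose Gaussian mean is `d`; this cancels `d⁻¹`, and the
  -- two terms recombine to `exp (a * p)` on the sphere.
  have hmono : ∫ x : F, (G₀ (‖x‖⁻¹ • x) * Real.exp (-‖x‖ ^ 2 / 2) +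
      d⁻¹ * (G₁ (‖x‖⁻¹ • x) * (‖x‖ ^ 2 * Real.exp (-‖x‖ ^ 2 / 2)))) ≤
      ∫ x : F, Real.exp (α / 2 * p x) * Real.exp (-‖x‖ ^ 2 / 2) := by
    refine integral_mono (hI₀.add (hI₁.const_mul _)) hI fun x => ?_
    have hx2 : p x = ‖x‖ ^ 2 * p (‖x‖⁻¹ • x) := by
      rw [hps]
      rcases eq_or_ne x 0 with rfl | hx
      · simp [hp]
      · have := norm_ne_zero_iff.2 hx
        field_simp
    set P := p (‖x‖⁻¹ • x)
    have htan : Real.exp (a * P) * (1 + (α / 2 * p x - a * P)) ≤ Real.exp (α / 2 * p x) := by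
      have := Real.add_one_le_exp (α / 2 * p x - a * P)
      calc Real.exp (a * P) * (1 + (α / 2 * p x - a * P))
          ≤ Real.exp (a * P) * Real.exp (α / 2 * p x - a * P) :=
            mul_le_mul_of_nonneg_left (by linarith) (Real.exp_pos _).le
        _ = Real.exp (α / 2 * p x) := by rw [← Real.exp_add]; congr 1; ring
    have e1 : α / 2 * p x = d⁻¹ * (a * P) * ‖x‖ ^ 2 := by
      rw [hx2, ha]; field_simp
    calc _ = Real.exp (a * P) * (1 + (d⁻¹ * (a * P) * ‖x‖ ^ 2 - a * P)) *
          Real.exp (-‖x‖ ^ 2 / 2) := by simp only [G₀, G₁]; ring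
      _ ≤ _ := by
          rw [← e1]
          exact mul_le_mul_of_nonneg_right htan (Real.exp_pos _).le
  rw [integral_add hI₀ (hI₁.const_mul _), integral_const_mul,
    integral_angular_mul_radial G₀ (fun t => Real.exp (-t ^ 2 / 2)),
    integral_angular_mul_radial G₁ (fun t => t ^ 2 * Real.exp (-t ^ 2 / 2)),
    integral_norm_sq_mul_gaussian, hval, ← hd] at hmono
  have hZ := integral_gaussian_pos (F := F)
  refine le_of_mul_le_mul_right ?_ hZ
  refine le_trans (le_of_eq ?_) hmono
  have hbd : ∀ᵐ x ∂(uniformSphere F), p x ≤ 1 :=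
    ae_norm_eq_one_uniformSphere.mono fun x hx => (hp1 x).trans (by rw [hx, one_pow])
  have hS₀ : Integrable G₀ (uniformSphere F) := by
    refine Integrable.of_bound (by fun_prop) (Real.exp a * (1 + a)) ?_
    filter_upwards [ae_norm_eq_one_uniformSphere] with x hx
    simpa [hx] using hG₀b x
  have hS₁ : Integrable G₁ (uniformSphere F) := by
    refine Integrable.of_bound (by fun_prop) (Real.exp a * a) ?_
    filter_upwards [ae_norm_eq_one_uniformSphere] with x hx
    simpa [hx] using hG₁b x
  have hsum : ∫ x, Real.exp (a * p x) ∂(uniformSphere F) =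
      ∫ x, G₀ x ∂(uniformSphere F) + ∫ x, G₁ x ∂(uniformSphere F) := by
    rw [← integral_add hS₀ hS₁]
    congr 1
    funext x
    simp only [G₀, G₁]
    ring
  rw [hsum]
  field_simp

end Sphere

/-! ### Laplace transforms of absolute correlations, and the smoothing inequality. -/

section Smoothing

variable {W : Type*} [NormedAddCommGroup W] [InnerProductSpace ℝ W] [FiniteDimensional ℝ W]
  [MeasurableSpace W] [BorelSpace W]

/-- A quadratic majorant, equal to `exp (-z)` at 0 and almost touching it near `z = 1`. It makes the
first two moments of `|⟨e, x⟩|` sufficient to bound the Laplace transform. The proof multiplies it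
by the degree 5 Taylor polynomial of `exp`. -/
theorem exp_neg_le_quadratic {z : ℝ} (hz : 0 ≤ z) :
    Real.exp (-z) ≤ 1 - 0.8964 * z + 0.267 * z ^ 2 := by
  have hpos : 0 < 1 - 0.8964 * z + 0.267 * z ^ 2 := by nlinarith [sq_nonneg (z - 1.6787)]
  have h := Real.sum_le_exp_of_nonneg hz 6
  simp only [Finset.sum_range_succ, Finset.sum_range_zero, Nat.factorial] at h
  norm_num at h
  rw [Real.exp_neg, inv_le_comm₀ (Real.exp_pos _) hpos]
  refine le_trans ?_ h
  rw [inv_le_iff_one_le_mul₀ hpos]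
  have h2 : 0 ≤ z * ((z - 1) ^ 2 * (0.05 + 0.1 * z ^ 2)) := by positivity
  have h3 : 0 ≤ z * (z - 1) ^ 2 := by positivity
  have h4 : 0 ≤ z ^ 2 * (z - 1) ^ 2 := by positivity
  have h5 : 0 ≤ z ^ 3 * (z - 1) ^ 2 := by positivity
  have h6 : 0 ≤ z ^ 4 := by positivity
  have h7 : 0 ≤ z ^ 5 := by positivity
  have h8 : 0 ≤ z ^ 6 := by positivity
  have h9 : 0 ≤ z ^ 7 := by positivity
  nlinarith

theorem exp_neg_const_ge : (0.59877 : ℝ) ≤ Real.exp (-0.512) := by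
  rw [Real.exp_neg, le_inv_comm₀ (by norm_num) (Real.exp_pos _)]
  have h := Real.exp_bound' (x := 0.512) (by norm_num) (by norm_num) (n := 6) (by norm_num)
  refine h.trans ?_
  simp only [Finset.sum_range_succ, Finset.sum_range_zero, Nat.factorial]
  norm_num

theorem sqrt_two_div_pi_ge : (0.7978 : ℝ) ≤ √(2 / Real.pi) := by
  apply Real.le_sqrt_of_sq_le
  rw [le_div_iff₀ Real.pi_pos]
  have := Real.pi_lt_d6
  norm_num at this ⊢
  linarith

/-- With first moment at least `0.7978 / √r` and second moment `1 / r`, the quadratic majorant gives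
`1 - 0.8964 * 0.8 * 0.7978 + 0.267 * 0.64 ≤ 0.59877`. -/
theorem integral_exp_neg_abs_inner_uniformSphere_le [Nontrivial W] {e : W} (he : ‖e‖ = 1) :
    ∫ x, Real.exp (-(0.8 * √(Module.finrank ℝ W) * |inner ℝ e x|)) ∂(uniformSphere W) ≤
      Real.exp (-0.512) := by
  set r : ℝ := (Module.finrank ℝ W : ℝ) with hr
  have hrpos : 0 < r := by rw [hr]; exact_mod_cast Module.finrank_pos (R := ℝ) (M := W)
  have hb : ∀ᵐ x ∂(uniformSphere W), |inner ℝ e x| ≤ 1 :=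
    ae_norm_eq_one_uniformSphere.mono fun x hx => by
      simpa [he, hx] using abs_real_inner_le_norm e x
  have i1 : Integrable (fun x => |inner ℝ e x|) (uniformSphere W) :=
    Integrable.of_bound (by fun_prop) 1 (hb.mono fun x hx => by simpa using hx)
  have i2 : Integrable (fun x => inner ℝ e x ^ 2) (uniformSphere W) :=
    Integrable.of_bound (by fun_prop) 1 (hb.mono fun x hx => by
      rw [Real.norm_eq_abs, abs_of_nonneg (sq_nonneg _), ← sq_abs]
      exact pow_le_one₀ (abs_nonneg _) hx)
  have i3 : Integrable (fun x => Real.exp (-(0.8 * √r * |inner ℝ e x|))) (uniformSphere W) :=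
    Integrable.of_bound (by fun_prop) 1 (Filter.Eventually.of_forall fun x => by
      rw [Real.norm_eq_abs, Real.abs_exp, Real.exp_le_one_iff]
      have : 0 ≤ 0.8 * √r * |inner ℝ e x| := by positivity
      linarith)
  have h1 := le_integral_abs_inner_uniformSphere (F := W) he
  have h2 := integral_inner_sq_uniformSphere (F := W) he
  rw [← hr] at h1 h2
  calc ∫ x, Real.exp (-(0.8 * √r * |inner ℝ e x|)) ∂(uniformSphere W)
      ≤ ∫ x, (1 - 0.8964 * (0.8 * √r) * |inner ℝ e x| + 0.267 * 0.64 * r * inner ℝ e x ^ 2)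
          ∂(uniformSphere W) := by
        refine integral_mono i3 (((integrable_const 1).sub (i1.const_mul _)).add
          (i2.const_mul _)) fun x => ?_
        refine (exp_neg_le_quadratic (by positivity)).trans (le_of_eq ?_)
        rw [mul_pow, mul_pow, Real.sq_sqrt hrpos.le, sq_abs]
        ring
    _ = 1 - 0.8964 * (0.8 * √r) * ∫ x, |inner ℝ e x| ∂(uniformSphere W) +
          0.267 * 0.64 * r * ∫ x, inner ℝ e x ^ 2 ∂(uniformSphere W) := by
        have i4 : Integrable (fun x => 1 - 0.8964 * (0.8 * √r) * |inner ℝ e x|)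
            (uniformSphere W) := (integrable_const 1).sub (i1.const_mul _)
        rw [integral_add i4 (i2.const_mul _),
          integral_sub (integrable_const 1) (i1.const_mul _), integral_const_mul,
          integral_const_mul]
        simp
    _ ≤ 0.59877 := by
        rw [h2]
        have h3 : √(2 / Real.pi) ≤ √r * ∫ x, |inner ℝ e x| ∂(uniformSphere W) := by
          rw [div_le_iff₀ (Real.sqrt_pos.2 hrpos)] at h1
          linarith
        have h4 : 0.267 * 0.64 * r * r⁻¹ = 0.267 * 0.64 := by field_simp
        rw [h4]
        have := sqrt_two_div_pi_ge
        linarith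
    _ ≤ _ := exp_neg_const_ge

theorem lintegral_exp_neg_abs_inner_uniformSphere_le [Nontrivial W] {v : W} (hv : 1 ≤ ‖v‖) :
    ∫⁻ x, ENNReal.ofReal (Real.exp (-(0.8 * √(Module.finrank ℝ W) * |inner ℝ x v|)))
      ∂(uniformSphere W) ≤ ENNReal.ofReal (Real.exp (-0.512)) := by
  have hv0 : ‖v‖ ≠ 0 := by positivity
  have he : ‖‖v‖⁻¹ • v‖ = 1 := by rw [norm_smul, norm_inv, norm_norm, inv_mul_cancel₀ hv0]
  refine le_trans ?_ (ENNReal.ofReal_le_ofReal (integral_exp_neg_abs_inner_uniformSphere_le he))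
  rw [ofReal_integral_eq_lintegral_ofReal]
  · refine lintegral_mono fun x => ENNReal.ofReal_le_ofReal (Real.exp_le_exp.2 ?_)
    rw [neg_le_neg_iff]
    refine mul_le_mul_of_nonneg_left ?_ (by positivity)
    rw [inner_smul_left, abs_mul, real_inner_comm]
    refine mul_le_of_le_one_left (abs_nonneg _) ?_
    simpa using inv_le_one_of_one_le₀ hv
  · exact Integrable.of_bound (by fun_prop) 1 (Filter.Eventually.of_forall fun x => by
      rw [Real.norm_eq_abs, Real.abs_exp, Real.exp_le_one_iff, Left.neg_nonpos_iff]
      positivity)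
  · exact Filter.Eventually.of_forall fun x => (Real.exp_pos _).le

variable {κ : Type*} [Fintype κ]

/-- Jensen's inequality on the ball, via the tangent line of `exp`. The mean of `|⟨a i, b⟩|` is at
most `s / √r`, by AM–GM from its second moment. -/
theorem le_lintegral_ball_exp_neg [Nontrivial W] (a : κ → W) (ha : ∀ i, ‖a i‖ = 1) {s c : ℝ}
    (hs : 0 < s) (hc : 0 ≤ c) :
    ENNReal.ofReal (Real.exp (-(c * (Fintype.card κ * (s / √(Module.finrank ℝ W)))))) *
        (volume : Measure W) (Metric.ball 0 s) ≤
      ∫⁻ b in Metric.ball (0 : W) s, ENNReal.ofReal (Real.exp (-(c * ∑ i, |inner ℝ (a i) b|))) := by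
  set r : ℝ := (Module.finrank ℝ W : ℝ) with hr
  have hrpos : 0 < r := by rw [hr]; exact_mod_cast Module.finrank_pos (R := ℝ) (M := W)
  set V : ℝ := (volume : Measure W).real (Metric.ball 0 s) with hV
  have hsr : 0 < √r := Real.sqrt_pos.2 hrpos
  have hrr : √r * √r = r := Real.mul_self_sqrt hrpos.le
  have : IsFiniteMeasure ((volume : Measure W).restrict (Metric.ball 0 s)) :=
    ⟨by simpa using measure_ball_lt_top⟩
  have hbd : ∀ i, ∀ᵐ b ∂((volume : Measure W).restrict (Metric.ball 0 s)),
      |inner ℝ (a i) b| ≤ s := fun i => by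
    filter_upwards [ae_restrict_mem measurableSet_ball] with b hb
    refine (abs_real_inner_le_norm _ _).trans ?_
    rw [ha, one_mul]
    exact (mem_ball_zero_iff.1 hb).le
  have i1 : ∀ i, Integrable (fun b => |inner ℝ (a i) b|)
      ((volume : Measure W).restrict (Metric.ball 0 s)) := fun i =>
    Integrable.of_bound (by fun_prop) s ((hbd i).mono fun x hx => by simpa using hx)
  have i2 : ∀ i, Integrable (fun b => inner ℝ (a i) b ^ 2)
      ((volume : Measure W).restrict (Metric.ball 0 s)) := fun i =>
    Integrable.of_bound (by fun_prop) (s ^ 2) ((hbd i).mono fun x hx => by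
      rw [Real.norm_eq_abs, abs_of_nonneg (sq_nonneg _), ← sq_abs]
      exact pow_le_pow_left₀ (abs_nonneg _) hx 2)
  have hmean : ∀ i, ∫ b in Metric.ball (0 : W) s, |inner ℝ (a i) b| ≤ s / √r * V := fun i => by
    calc ∫ b in Metric.ball (0 : W) s, |inner ℝ (a i) b|
        ≤ ∫ b in Metric.ball (0 : W) s, (√r / (2 * s) * inner ℝ (a i) b ^ 2 + s / (2 * √r)) := by
          refine integral_mono (i1 i) (((i2 i).const_mul _).add (integrable_const _)) fun b => ?_
          simp only
          rw [← sub_nonneg, ← sq_abs (inner ℝ (a i) b)]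
          have : √r / (2 * s) * |inner ℝ (a i) b| ^ 2 + s / (2 * √r) - |inner ℝ (a i) b| =
              (√r * |inner ℝ (a i) b| - s) ^ 2 / (2 * s * √r) := by
            field_simp
            ring
          rw [this]
          positivity
      _ = √r / (2 * s) * (∫ b in Metric.ball (0 : W) s, inner ℝ (a i) b ^ 2) +
            s / (2 * √r) * V := by
          rw [integral_add ((i2 i).const_mul _) (integrable_const _), integral_const_mul]
          simp [hV, mul_comm]
      _ ≤ √r / (2 * s) * (s ^ 2 / r * V) + s / (2 * √r) * V := by
          refine add_le_add_left (mul_le_mul_of_nonneg_left ?_ (by positivity)) _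
          exact integral_ball_inner_sq_le (ha i) s
      _ = s / √r * V := by
          have : √r / (2 * s) * (s ^ 2 / r * V) = s / (2 * √r) * V := by
            rw [div_mul_eq_mul_div, div_eq_iff (by positivity)]
            field_simp
            rw [Real.sq_sqrt hrpos.le]
          rw [this]
          field_simp
          ring
  set m : ℝ := c * (Fintype.card κ * (s / √r)) with hm
  have hf : Integrable (fun b => ∑ i, |inner ℝ (a i) b|)
      ((volume : Measure W).restrict (Metric.ball 0 s)) := integrable_finsetSum _ fun i _ => i1 i
  have i3 : Integrable (fun b => Real.exp (-(c * ∑ i, |inner ℝ (a i) b|)))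
      ((volume : Measure W).restrict (Metric.ball 0 s)) :=
    Integrable.of_bound (by fun_prop) 1 (Filter.Eventually.of_forall fun b => by
      rw [Real.norm_eq_abs, Real.abs_exp, Real.exp_le_one_iff, Left.neg_nonpos_iff]
      positivity)
  rw [← ofReal_integral_eq_lintegral_ofReal i3
    (Filter.Eventually.of_forall fun b => (Real.exp_pos _).le),
    ← ENNReal.ofReal_toReal (measure_ball_lt_top (μ := (volume : Measure W))).ne,
    ← ENNReal.ofReal_mul (Real.exp_pos _).le]
  refine ENNReal.ofReal_le_ofReal ?_
  change Real.exp (-m) * V ≤ _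
  calc Real.exp (-m) * V ≤ Real.exp (-m) * ((1 + m) * V
        - c * ∫ b in Metric.ball (0 : W) s, ∑ i, |inner ℝ (a i) b|) := by
        refine mul_le_mul_of_nonneg_left ?_ (Real.exp_pos _).le
        have : c * ∫ b in Metric.ball (0 : W) s, ∑ i, |inner ℝ (a i) b| ≤ m * V := by
          rw [integral_finsetSum _ fun i _ => i1 i, hm, mul_assoc]
          refine mul_le_mul_of_nonneg_left ?_ hc
          refine (Finset.sum_le_sum fun i _ => hmean i).trans (le_of_eq ?_)
          simp [mul_assoc]
        linarith
    _ = ∫ b in Metric.ball (0 : W) s,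
          Real.exp (-m) * ((1 + m) - c * ∑ i, |inner ℝ (a i) b|) := by
        rw [integral_const_mul, integral_sub (integrable_const _) (hf.const_mul _),
          integral_const_mul]
        simp [hV, mul_comm]
    _ ≤ _ := by
        refine integral_mono (((integrable_const _).sub (hf.const_mul _)).const_mul _) i3
          fun b => ?_
        have := Real.add_one_le_exp (m - c * ∑ i, |inner ℝ (a i) b|)
        calc _ ≤ Real.exp (-m) * Real.exp (m - c * ∑ i, |inner ℝ (a i) b|) :=
              mul_le_mul_of_nonneg_left (by linarith) (Real.exp_pos _).le
          _ = _ := by rw [← Real.exp_add]; congr 1; ring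

/-- Subadditivity of `f v = ∑ |⟨a i, v⟩|` gives `exp (-c f u) exp (-c f b) ≤ exp (-c f (u + b))`.
Only the half ball `⟨b, u⟩ ≥ 0` is translated, because there `‖u + b‖ ≥ 1`, where the Laplace bound
applies. By the symmetry `b ↦ -b` this costs the factor 2. -/
theorem mul_lintegral_ball_le_lintegral_shell (a : κ → W) {s c : ℝ} (hc : 0 ≤ c) {u : W}
    (hu : ‖u‖ = 1) :
    ENNReal.ofReal (Real.exp (-(c * ∑ i, |inner ℝ (a i) u|))) *
        ∫⁻ b in Metric.ball (0 : W) s, ENNReal.ofReal (Real.exp (-(c * ∑ i, |inner ℝ (a i) b|))) ≤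
      2 * ∫⁻ v in Metric.ball (0 : W) (1 + s) ∩ {v | 1 ≤ ‖v‖},
        ENNReal.ofReal (Real.exp (-(c * ∑ i, |inner ℝ (a i) v|))) := by
  set g : W → ENNReal := fun b => ENNReal.ofReal (Real.exp (-(c * ∑ i, |inner ℝ (a i) b|))) with hg
  have hgm : Measurable g := by fun_prop
  have hgneg : ∀ b, g (-b) = g b := fun b => by simp [hg]
  have hsub : ∀ b, g u * g b ≤ g (u + b) := fun b => by
    rw [hg, ← ENNReal.ofReal_mul (Real.exp_pos _).le, ← Real.exp_add]
    refine ENNReal.ofReal_le_ofReal (Real.exp_le_exp.2 ?_)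
    rw [← neg_add, neg_le_neg_iff, ← mul_add, ← Finset.sum_add_distrib]
    refine mul_le_mul_of_nonneg_left (Finset.sum_le_sum fun i _ => ?_) hc
    rw [inner_add_right]
    exact abs_add_le _ _
  set B := Metric.ball (0 : W) s
  set Hp : Set W := B ∩ {b | 0 ≤ inner ℝ b u}
  set Hm : Set W := B ∩ {b | inner ℝ b u ≤ 0}
  have hHp : MeasurableSet Hp :=
    measurableSet_ball.inter (measurableSet_le measurable_const (by fun_prop))
  have hHm : MeasurableSet Hm :=
    measurableSet_ball.inter (measurableSet_le (by fun_prop) measurable_const)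
  have hsymm : ∫⁻ b in Hm, g b = ∫⁻ b in Hp, g b := by
    rw [← lintegral_indicator hHm, ← lintegral_indicator hHp,
      ← lintegral_neg_eq_self (fun b => Hm.indicator g b)]
    refine lintegral_congr fun b => ?_
    have : -b ∈ Hm ↔ b ∈ Hp := by simp [Hm, Hp, B]
    by_cases hb : b ∈ Hp
    · rw [Set.indicator_of_mem (this.2 hb), Set.indicator_of_mem hb, hgneg]
    · rw [Set.indicator_of_notMem (fun h => hb (this.1 h)), Set.indicator_of_notMem hb]
  have hball : ∫⁻ b in B, g b ≤ 2 * ∫⁻ b in Hp, g b := by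
    have : B = Hp ∪ Hm := by
      ext b
      simp only [Hp, Hm, Set.mem_union, Set.mem_inter_iff, Set.mem_ofPred_eq]
      have := le_total 0 (inner ℝ b u)
      tauto
    calc ∫⁻ b in B, g b ≤ (∫⁻ b in Hp, g b) + ∫⁻ b in Hm, g b := by
          rw [this]
          exact lintegral_union_le _ _ _
      _ = 2 * ∫⁻ b in Hp, g b := by rw [hsymm, two_mul]
  have hshift : g u * ∫⁻ b in Hp, g b ≤
      ∫⁻ v in Metric.ball (0 : W) (1 + s) ∩ {v | 1 ≤ ‖v‖}, g v := by
    have hK : MeasurableSet (Metric.ball (0 : W) (1 + s) ∩ {v | 1 ≤ ‖v‖}) :=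
      measurableSet_ball.inter (measurableSet_le measurable_const (by fun_prop))
    rw [← lintegral_const_mul _ hgm, ← lintegral_indicator hHp, ← lintegral_indicator hK,
      ← lintegral_add_left_eq_self (fun v =>
        (Metric.ball (0 : W) (1 + s) ∩ {v | 1 ≤ ‖v‖}).indicator g v) u]
    refine lintegral_mono fun b => ?_
    by_cases hb : b ∈ Hp
    · have hmem : u + b ∈ Metric.ball (0 : W) (1 + s) ∩ {v | 1 ≤ ‖v‖} := by
        constructor
        · rw [mem_ball_zero_iff]
          have := mem_ball_zero_iff.1 hb.1
          linarith [norm_add_le u b]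
        · have h1 : 0 ≤ inner ℝ b u := hb.2
          have h2 : inner ℝ (u + b) u = 1 + inner ℝ b u := by
            rw [inner_add_left, real_inner_self_eq_norm_sq, hu, one_pow]
          have h3 := real_inner_le_norm (u + b) u
          rw [hu, mul_one] at h3
          change 1 ≤ ‖u + b‖
          linarith
      rw [Set.indicator_of_mem hb, Set.indicator_of_mem hmem]
      exact hsub b
    · rw [Set.indicator_of_notMem hb]
      exact zero_le
  calc g u * ∫⁻ b in B, g b ≤ g u * (2 * ∫⁻ b in Hp, g b) := by gcongr
    _ = 2 * (g u * ∫⁻ b in Hp, g b) := by ring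
    _ ≤ _ := by gcongr

end Smoothing

/-! ### Uniform lower bound for the inlier correlations. -/

section Inliers

variable {Ω : Type*} [MeasurableSpace Ω] {P : Measure Ω} {M : ℕ}
  {U : Submodule ℝ (EuclideanSpace ℝ (Fin M))}

theorem ae_uniformSphereIn : ∀ᵐ x ∂(uniformSphereIn U), x ∈ U ∧ ‖x‖ = 1 := by
  have hm : MeasurableSet {x : EuclideanSpace ℝ (Fin M) | x ∈ U ∧ ‖x‖ = 1} :=
    (Submodule.closed_of_finiteDimensional U).measurableSet.inter
      (measurableSet_eq_fun (by fun_prop) (by fun_prop))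
  rw [uniformSphereIn, ae_map_iff (by fun_prop) hm]
  exact ae_norm_eq_one_uniformSphere.mono fun x hx => ⟨x.2, hx⟩

variable {κ : Type*} [Fintype κ] {A : κ → Ω → EuclideanSpace ℝ (Fin M)}

theorem lintegral_exp_neg_sum_abs_inner_le [Nontrivial U] (hA : ∀ i, Measurable (A i))
    (hind : iIndepFun A P) (hlaw : ∀ i, P.map (A i) = uniformSphereIn U) {v : U} (hv : 1 ≤ ‖v‖) :
    ∫⁻ ω, ENNReal.ofReal (Real.exp (-(0.8 * √(Module.finrank ℝ U) *
        ∑ i, |inner ℝ (A i ω) (v : EuclideanSpace ℝ (Fin M))|))) ∂P ≤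
      ENNReal.ofReal (Real.exp (-0.512)) ^ Fintype.card κ := by
  set g : EuclideanSpace ℝ (Fin M) → ENNReal := fun x => ENNReal.ofReal (Real.exp
    (-(0.8 * √(Module.finrank ℝ U) * |inner ℝ x (v : EuclideanSpace ℝ (Fin M))|))) with hg
  have hgm : Measurable g := by fun_prop
  calc _ = ∫⁻ ω, ∏ i, g (A i ω) ∂P := by
        refine lintegral_congr fun ω => ?_
        rw [hg, ← ENNReal.ofReal_prod_of_nonneg fun i _ => (Real.exp_pos _).le, ← Real.exp_sum,
          Finset.sum_neg_distrib, Finset.mul_sum]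
    _ = ∏ i, ∫⁻ ω, g (A i ω) ∂P :=
        lintegral_prod_eq_prod_lintegral_of_indepFun _ (fun i ω => g (A i ω))
          (hind.comp (fun _ => g) fun _ => hgm) fun i => hgm.comp (hA i)
    _ ≤ ∏ _i : κ, ENNReal.ofReal (Real.exp (-0.512)) := by
        refine Finset.prod_le_prod' fun i _ => ?_
        rw [← lintegral_map hgm (hA i), hlaw, uniformSphereIn, lintegral_map hgm (by fun_prop)]
        exact lintegral_exp_neg_abs_inner_uniformSphere_le hv
    _ = _ := by simp

/-- With probability at least `1 - 2 δ`, the sum of the absolute correlations of inliers with a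
unit vector of `U` is large uniformly over all unit vectors of `U`. -/
theorem measure_exists_sum_abs_inner_lt_le [IsProbabilityMeasure P] (hU : 0 < Module.finrank ℝ U)
    (hA : ∀ i, Measurable (A i))
    (hind : iIndepFun A P) (hlaw : ∀ i, P.map (A i) = uniformSphereIn U) {δ : ℝ} (hδ : 0 < δ) :
    P {ω | ∃ u ∈ U, ‖u‖ = 1 ∧ 0.8 * √(Module.finrank ℝ U) * ∑ i, |inner ℝ (A i ω) u| <
      0.3864 * Fintype.card κ - (2 * Module.finrank ℝ U + Real.log (1 / δ))} ≤
      ENNReal.ofReal (2 * δ) := by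
  have : Nontrivial U := Module.nontrivial_of_finrank_pos hU
  set r : ℕ := Module.finrank ℝ U with hr
  set n : ℕ := Fintype.card κ with hn
  have hrpos : (0 : ℝ) < r := by exact_mod_cast hU
  set c : ℝ := 0.8 * √r with hc
  have hc0 : 0 ≤ c := by positivity
  -- Chosen just large enough for `(1 + s) / s ≤ exp 2`, so that the volume ratio of the balls is at
  -- most `exp (2 * r)`.
  let s : ℝ := 0.157
  let K : Set U := Metric.ball (0 : U) (1 + s) ∩ {v | 1 ≤ ‖v‖}
  let h : Ω → U → ENNReal := fun ω v => ENNReal.ofReal (Real.exp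
    (-(c * ∑ i, |inner ℝ (A i ω) (v : EuclideanSpace ℝ (Fin M))|)))
  have hhm : Measurable (Function.uncurry h) := by
    refine ENNReal.measurable_ofReal.comp (Real.measurable_exp.comp
      (Measurable.neg (Measurable.const_mul (Finset.measurable_sum _ fun i _ => ?_) c)))
    refine _root_.continuous_abs.measurable.comp ?_
    exact ((hA i).comp measurable_fst).inner (measurable_subtype_coe.comp measurable_snd)
  let Φ : Ω → ENNReal := fun ω => ∫⁻ v in K, h ω v
  have hKm : MeasurableSet K :=
    measurableSet_ball.inter (measurableSet_le measurable_const (by fun_prop))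
  have hΦm : Measurable Φ := hhm.lintegral_prod_right'
  set V : ENNReal := (volume : Measure U) (Metric.ball 0 1) with hV
  have hV0 : V ≠ 0 := (Metric.measure_ball_pos _ _ one_pos).ne'
  have hVt : V ≠ ⊤ := measure_ball_lt_top.ne
  have hΦ : ∫⁻ ω, Φ ω ∂P ≤
      ENNReal.ofReal (Real.exp (-0.512) ^ n * (1 + s) ^ r) * V := by
    calc ∫⁻ ω, Φ ω ∂P = ∫⁻ v in K, ∫⁻ ω, h ω v ∂P :=
          lintegral_lintegral_swap hhm.aemeasurable
      _ ≤ ∫⁻ v in K, ENNReal.ofReal (Real.exp (-0.512)) ^ n :=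
          setLIntegral_mono measurable_const fun v hv =>
            lintegral_exp_neg_sum_abs_inner_le hA hind hlaw hv.2
      _ = ENNReal.ofReal (Real.exp (-0.512)) ^ n * (volume : Measure U) K := by simp
      _ ≤ ENNReal.ofReal (Real.exp (-0.512)) ^ n *
            (volume : Measure U) (Metric.ball 0 (1 + s)) := by
          gcongr
          exact Set.inter_subset_left
      _ = _ := by
          rw [Measure.addHaar_ball_of_pos _ _ (by norm_num [s]), ← hr, ← hV,
            ← ENNReal.ofReal_pow (Real.exp_pos _).le, ← mul_assoc,
            ← ENNReal.ofReal_mul (by positivity)]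
  -- The bound on the mean of `Φ` divided by `2 * δ`. The 2 is the loss from the half ball and
  -- accounts for the probability `2 * δ`.
  let T : ENNReal := ENNReal.ofReal (Real.exp (-0.512) ^ n * (1 + s) ^ r / (2 * δ)) * V
  have hs0 : 0 < s := by norm_num [s]
  have hTpos : 0 < Real.exp (-0.512) ^ n * (1 + s) ^ r / (2 * δ) := by positivity
  have hT0 : T ≠ 0 := mul_ne_zero (by simpa using hTpos) hV0
  have hTt : T ≠ ⊤ := ENNReal.mul_ne_top ENNReal.ofReal_ne_top hVt
  have hmarkov : P {ω | T ≤ Φ ω} ≤ ENNReal.ofReal (2 * δ) := by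
    have h1 := (mul_meas_ge_le_lintegral (μ := P) hΦm T).trans hΦ
    have h2 : ENNReal.ofReal (Real.exp (-0.512) ^ n * (1 + s) ^ r) * V =
        T * ENNReal.ofReal (2 * δ) := by
      rw [mul_right_comm, ← ENNReal.ofReal_mul hTpos.le]
      congr 2
      field_simp
    rw [h2] at h1
    exact (ENNReal.mul_le_mul_iff_right hT0 hTt).1 h1
  refine le_trans (measure_mono_ae ?_) hmarkov
  have hae : ∀ᵐ ω ∂P, ∀ i, A i ω ∈ U ∧ ‖A i ω‖ = 1 := by
    rw [ae_all_iff]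
    intro i
    exact ae_of_ae_map (hA i).aemeasurable (by rw [hlaw]; exact ae_uniformSphereIn)
  filter_upwards [hae] with ω hω
  rintro ⟨u, huU, hu, hlt⟩
  let a : κ → U := fun i => ⟨A i ω, (hω i).1⟩
  have k1 := le_lintegral_ball_exp_neg a (fun i => (hω i).2) hs0 hc0
  have k2 := mul_lintegral_ball_le_lintegral_shell a (s := s) hc0 (u := ⟨u, huU⟩) hu
  have k3 := (mul_le_mul_right k1 _).trans k2
  rw [Measure.addHaar_ball_of_pos _ _ hs0, ← hr, ← hV, ← mul_assoc, ← mul_assoc,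
    ← ENNReal.ofReal_mul (Real.exp_pos _).le, ← ENNReal.ofReal_mul (by positivity)] at k3
  have k4 : 2 * T ≤ 2 * Φ ω := by
    refine le_trans ?_ k3
    change 2 * (_ * V) ≤ _
    have two : ∀ x : ℝ, 2 * ENNReal.ofReal x = ENNReal.ofReal (2 * x) := fun x => by
      rw [ENNReal.ofReal_mul zero_le_two, ENNReal.ofReal_ofNat]
    rw [← mul_assoc, two]
    refine mul_le_mul_left (ENNReal.ofReal_le_ofReal ?_) _
    rw [← Real.exp_nat_mul]
    have e0 : 1 + s ≤ Real.exp 2 * s := by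
      have : Real.exp 2 = Real.exp 1 * Real.exp 1 := by rw [← Real.exp_add]; norm_num
      rw [this]
      have := Real.exp_one_gt_d9
      norm_num [s] at this ⊢
      nlinarith
    have e1 : (1 + s) ^ r ≤ Real.exp (2 * r) * s ^ r := by
      rw [mul_comm (2 : ℝ), Real.exp_nat_mul, ← mul_pow]
      exact pow_le_pow_left₀ (by positivity) e0 r
    -- The Jensen loss `0.8 * 0.157 = 0.1256` per inlier leaves the rate `0.512 - 0.1256 = 0.3864`
    -- of the statement.
    have e2 : c * (n * (s / √r)) = 0.1256 * n := by
      have h1 : √(r : ℝ) / √(r : ℝ) = 1 := div_self (Real.sqrt_pos.2 hrpos).ne'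
      change 0.8 * √(r : ℝ) * (n * (0.157 / √(r : ℝ))) = 0.1256 * n
      linear_combination (0.1256 * (n : ℝ)) * h1
    have e3 : Real.exp (Real.log (1 / δ)) = 1 / δ := Real.exp_log (by positivity)
    change _ ≤ Real.exp (-(c * ∑ i, |inner ℝ (A i ω) u|)) * Real.exp (-(c * (n * (s / √r)))) * s ^ r
    rw [e2, ← Real.exp_add]
    calc 2 * (Real.exp (n * -0.512) * (1 + s) ^ r / (2 * δ))
        = Real.exp (n * -0.512) * (1 / δ) * (1 + s) ^ r := by field_simp
      _ ≤ Real.exp (n * -0.512) * (1 / δ) * (Real.exp (2 * r) * s ^ r) :=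
          mul_le_mul_of_nonneg_left e1 (by positivity)
      _ = Real.exp (n * -0.512 + Real.log (1 / δ) + 2 * r) * s ^ r := by
          rw [Real.exp_add, Real.exp_add, e3]; ring
      _ ≤ _ := by
          refine mul_le_mul_of_nonneg_right (Real.exp_le_exp.2 ?_) (by positivity)
          linarith
  exact (ENNReal.mul_le_mul_iff_right two_ne_zero ENNReal.ofNat_ne_top).1 k4

end Inliers

/-! ### Exponential moments of projections of a uniform point. -/

section SphereTails

variable {F : Type*} [NormedAddCommGroup F] [InnerProductSpace ℝ F] [FiniteDimensional ℝ F]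
  [MeasurableSpace F] [BorelSpace F]

theorem lintegral_exp_sum_sq_uniformSphere_le [Nontrivial F] {ι : Type*} [Fintype ι]
    (b : OrthonormalBasis ι ℝ F) (s : Finset ι) {α : ℝ} (hα0 : 0 ≤ α) (hα1 : α < 1) :
    ∫⁻ x, ENNReal.ofReal (Real.exp (α * Module.finrank ℝ F / 2 *
      ∑ i ∈ s, inner ℝ (b i) x ^ 2)) ∂(uniformSphere F) ≤
      ENNReal.ofReal ((√(1 - α))⁻¹ ^ s.card) := by
  refine le_trans (le_of_eq ?_)
    (ENNReal.ofReal_le_ofReal (integral_exp_sum_sq_uniformSphere_le b s hα0 hα1))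
  rw [ofReal_integral_eq_lintegral_ofReal _
    (Filter.Eventually.of_forall fun x => (Real.exp_pos _).le)]
  refine Integrable.of_bound (by fun_prop) (Real.exp (α * Module.finrank ℝ F / 2)) ?_
  filter_upwards [ae_norm_eq_one_uniformSphere] with x hx
  rw [Real.norm_eq_abs, Real.abs_exp, Real.exp_le_exp]
  refine mul_le_of_le_one_right (by positivity) ?_
  calc ∑ i ∈ s, inner ℝ (b i) x ^ 2 ≤ ∑ i, inner ℝ (b i) x ^ 2 :=
        Finset.sum_le_univ_sum_of_nonneg fun i => sq_nonneg _
    _ = 1 := by rw [b.sum_sq_inner_right x, hx, one_pow]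

theorem lintegral_exp_inner_sq_uniformSphere_le [Nontrivial F] {h : F} (hh : ‖h‖ ≤ 1) {α : ℝ}
    (hα0 : 0 ≤ α) (hα1 : α < 1) :
    ∫⁻ x, ENNReal.ofReal (Real.exp (α * Module.finrank ℝ F / 2 * inner ℝ x h ^ 2))
      ∂(uniformSphere F) ≤ ENNReal.ofReal (√(1 - α))⁻¹ := by
  obtain ⟨e, he, hle⟩ : ∃ e : F, ‖e‖ = 1 ∧ ∀ x, inner ℝ x h ^ 2 ≤ inner ℝ e x ^ 2 := by
    rcases eq_or_ne h 0 with rfl | h0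
    · obtain ⟨e, he⟩ := exists_norm_eq F zero_le_one
      exact ⟨e, he, fun x => by simpa using sq_nonneg _⟩
    · have hn : ‖h‖ ≠ 0 := norm_ne_zero_iff.2 h0
      refine ⟨‖h‖⁻¹ • h, by rw [norm_smul, norm_inv, norm_norm, inv_mul_cancel₀ hn], fun x => ?_⟩
      rw [inner_smul_left, real_inner_comm, mul_pow]
      refine le_mul_of_one_le_left (sq_nonneg _) (one_le_pow₀ ?_)
      simpa using (one_le_inv₀ (by positivity)).2 hh
  obtain ⟨b, i, rfl⟩ := exists_orthonormalBasis_of_norm_eq_one he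
  have := lintegral_exp_sum_sq_uniformSphere_le b {i} hα0 hα1
  simp only [Finset.sum_singleton, Finset.card_singleton, pow_one] at this
  refine le_trans (lintegral_mono fun x => ?_) this
  exact ENNReal.ofReal_le_ofReal (Real.exp_le_exp.2
    (mul_le_mul_of_nonneg_left (hle x) (by positivity)))

theorem lintegral_exp_norm_sq_projection_uniformSphere_le [Nontrivial F] (V : Submodule ℝ F)
    {α : ℝ} (hα0 : 0 ≤ α) (hα1 : α < 1) :
    ∫⁻ x, ENNReal.ofReal (Real.exp (α * Module.finrank ℝ F / 2 * ‖V.starProjection x‖ ^ 2))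
      ∂(uniformSphere F) ≤ ENNReal.ofReal ((√(1 - α))⁻¹ ^ Module.finrank ℝ V) := by
  classical
  set m := Module.finrank ℝ V with hm
  set d := Module.finrank ℝ F with hd
  have hmd : m ≤ d := Submodule.finrank_le V
  let e := stdOrthonormalBasis ℝ V
  let v : Fin m ⊕ Fin (d - m) → F := Sum.elim (fun i => (e i : F)) 0
  have hv : Orthonormal ℝ ((Set.range (Sum.inl : Fin m → Fin m ⊕ Fin (d - m))).domRestrict v) := by
    refine ⟨?_, ?_⟩
    · rintro ⟨_, i, rfl⟩
      exact e.orthonormal.1 i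
    · rintro ⟨_, i, rfl⟩ ⟨_, j, rfl⟩ hij
      exact e.orthonormal.2 fun h => hij (by rw [h])
  obtain ⟨b, hb⟩ := hv.exists_orthonormalBasis_extension_of_card_eq (by simp; omega)
  have hbe : ∀ i, b (Sum.inl i) = e i := fun i => by simpa [v] using hb (Sum.inl i) ⟨i, rfl⟩
  have hproj : ∀ x, ‖V.starProjection x‖ ^ 2 =
      ∑ i ∈ Finset.univ.map (⟨Sum.inl, Sum.inl_injective⟩ : Fin m ↪ Fin m ⊕ Fin (d - m)),
        inner ℝ (b i) x ^ 2 := by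
    intro x
    have h1 := e.sum_sq_inner_right (V.orthogonalProjectionOnto x)
    rw [Finset.sum_map, V.starProjection_apply, ← Submodule.coe_norm, ← h1]
    refine Finset.sum_congr rfl fun i _ => ?_
    simp [hbe]
  have := lintegral_exp_sum_sq_uniformSphere_le b
    (Finset.univ.map (⟨Sum.inl, Sum.inl_injective⟩ : Fin m ↪ Fin m ⊕ Fin (d - m))) hα0 hα1
  simpa only [← hproj, Finset.card_map, Finset.card_univ, Fintype.card_fin] using this

end SphereTails

/-! ### Tail bounds for the outliers. -/

section Outliers

variable {Ω : Type*} [MeasurableSpace Ω] {P : Measure Ω} [IsProbabilityMeasure P]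
  {F : Type*} [NormedAddCommGroup F] [InnerProductSpace ℝ F] [FiniteDimensional ℝ F]
  [MeasurableSpace F] [BorelSpace F] {κ : Type*} [Fintype κ] {B : κ → Ω → F}

omit [IsProbabilityMeasure P] in
/-- Markov's inequality for the exponential of a random variable. -/
theorem measure_le_exp_moment {X : Ω → ℝ} (hX : Measurable X) (t c : ℝ) (ht : 0 < t)
    {q : ℝ} (h : ∫⁻ ω, ENNReal.ofReal (Real.exp (t * X ω)) ∂P ≤ ENNReal.ofReal q) :
    P {ω | c ≤ X ω} ≤ ENNReal.ofReal (Real.exp (-(t * c)) * q) := by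
  have h1 := (mul_meas_ge_le_lintegral (μ := P)
    (f := fun ω => ENNReal.ofReal (Real.exp (t * X ω))) (by fun_prop)
    (ENNReal.ofReal (Real.exp (t * c)))).trans h
  have hset : {ω | ENNReal.ofReal (Real.exp (t * c)) ≤ ENNReal.ofReal (Real.exp (t * X ω))} =
      {ω | c ≤ X ω} := by
    ext ω
    simp only [Set.mem_ofPred_eq]
    rw [ENNReal.ofReal_le_ofReal_iff (Real.exp_pos _).le, Real.exp_le_exp,
      mul_le_mul_iff_right₀ ht]
  rw [hset] at h1
  rw [ENNReal.ofReal_mul (Real.exp_pos _).le]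
  calc P {ω | c ≤ X ω} = ENNReal.ofReal (Real.exp (-(t * c))) *
        (ENNReal.ofReal (Real.exp (t * c)) * P {ω | c ≤ X ω}) := by
        rw [← mul_assoc, ← ENNReal.ofReal_mul (Real.exp_pos _).le, ← Real.exp_add]
        simp
    _ ≤ _ := mul_le_mul_right h1 _

omit [IsProbabilityMeasure P] in
-- Chernoff with `α = 1 / 2` gives the exponent `-d / 16 + m log 2 / 2`, where `m ≤ d / 9`; this is
-- below `-d / 72 ≤ -log (1 / q)`. Then a union bound.
theorem measure_exists_norm_sq_projection_ge_le [Nontrivial F] (hB : ∀ k, Measurable (B k))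
    (hlaw : ∀ k, P.map (B k) = uniformSphere F) (V : Submodule ℝ F) {q : ℝ} (hq : 0 < q)
    (h9 : 9 * (Module.finrank ℝ V : ℝ) ≤ Module.finrank ℝ F)
    (h72 : 72 * Real.log (1 / q) ≤ Module.finrank ℝ F) :
    P {ω | ∃ k, 1 / 4 ≤ ‖V.starProjection (B k ω)‖ ^ 2} ≤
      Fintype.card κ * ENNReal.ofReal q := by
  have hdpos : (0 : ℝ) < Module.finrank ℝ F := by
    exact_mod_cast Module.finrank_pos (R := ℝ) (M := F)
  set d : ℝ := (Module.finrank ℝ F : ℝ) with hd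
  set m : ℕ := Module.finrank ℝ V with hm
  have hk : ∀ k, P {ω | 1 / 4 ≤ ‖V.starProjection (B k ω)‖ ^ 2} ≤ ENNReal.ofReal q := by
    intro k
    have h0 := lintegral_exp_norm_sq_projection_uniformSphere_le V (α := 1 / 2) (by norm_num)
      (by norm_num)
    rw [← hlaw k, lintegral_map (by fun_prop) (hB k), ← hd, ← hm] at h0
    have hmeas : Measurable fun ω => ‖V.starProjection (B k ω)‖ ^ 2 :=
      (V.starProjection.continuous.measurable.comp (hB k)).norm.pow_const 2
    refine (measure_le_exp_moment hmeas _ (1 / 4) (by positivity) h0).trans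
      (ENNReal.ofReal_le_ofReal ?_)
    have e1 : (√(1 - 1 / 2 : ℝ))⁻¹ = Real.exp (Real.log 2 / 2) := by
      rw [Real.exp_half, Real.exp_log two_pos, ← Real.sqrt_inv]
      norm_num
    have e2 : q = Real.exp (-Real.log (1 / q)) := by
      rw [one_div, Real.log_inv, neg_neg, Real.exp_log hq]
    rw [e1, ← Real.exp_nat_mul, ← Real.exp_add, e2, Real.exp_le_exp]
    have hl := Real.log_two_lt_d9
    have hl0 := Real.log_pos one_lt_two
    have : (m : ℝ) * Real.log 2 ≤ d / 9 * 0.6931471808 :=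
      mul_le_mul (by linarith) hl.le hl0.le (by positivity)
    linarith
  calc P {ω | ∃ k, 1 / 4 ≤ ‖V.starProjection (B k ω)‖ ^ 2}
      = P (⋃ k, {ω | 1 / 4 ≤ ‖V.starProjection (B k ω)‖ ^ 2}) := by
        congr 1; ext ω; simp
    _ ≤ ∑ k, P {ω | 1 / 4 ≤ ‖V.starProjection (B k ω)‖ ^ 2} := measure_iUnion_fintype_le _ _
    _ ≤ ∑ _k : κ, ENNReal.ofReal q := Finset.sum_le_sum fun k _ => hk k
    _ = _ := by simp

/-- The direction `H (B j)` is random but independent of the remaining columns. Fubini freezes it,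
and for a fixed direction the moment factors over the columns. -/
theorem lintegral_exp_sum_inner_sq_le [DecidableEq κ] [Nontrivial F] (hB : ∀ k, Measurable (B k))
    (hind : iIndepFun B P) (hlaw : ∀ k, P.map (B k) = uniformSphere F) {H : F → F}
    (hH : Measurable H) (hH1 : ∀ x, ‖H x‖ ≤ 1) (j : κ) {α : ℝ} (hα0 : 0 ≤ α) (hα1 : α < 1) :
    ∫⁻ ω, ENNReal.ofReal (Real.exp (α * Module.finrank ℝ F / 2 *
      ∑ k ∈ Finset.univ.erase j, inner ℝ (B k ω) (H (B j ω)) ^ 2)) ∂P ≤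
      ENNReal.ofReal ((√(1 - α))⁻¹ ^ (Finset.univ.erase j).card) := by
  set S : Finset κ := Finset.univ.erase j with hS
  set t : ℝ := α * Module.finrank ℝ F / 2 with ht
  have hfix : ∀ y : F, ∫⁻ ω, ENNReal.ofReal (Real.exp (t * ∑ k ∈ S, inner ℝ (B k ω) (H y) ^ 2)) ∂P ≤
      ENNReal.ofReal ((√(1 - α))⁻¹ ^ S.card) := by
    intro y
    let g : F → ENNReal := fun x => ENNReal.ofReal (Real.exp (t * inner ℝ x (H y) ^ 2))
    have hgm : Measurable g := by fun_prop
    calc _ = ∫⁻ ω, ∏ k ∈ S, g (B k ω) ∂P := by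
          refine lintegral_congr fun ω => ?_
          rw [← ENNReal.ofReal_prod_of_nonneg fun i _ => (Real.exp_pos _).le, ← Real.exp_sum,
            Finset.mul_sum]
      _ = ∏ k ∈ S, ∫⁻ ω, g (B k ω) ∂P :=
          lintegral_prod_eq_prod_lintegral_of_indepFun _ (fun k ω => g (B k ω))
            (hind.comp (fun _ => g) fun _ => hgm) fun k => hgm.comp (hB k)
      _ ≤ ∏ _k ∈ S, ENNReal.ofReal (√(1 - α))⁻¹ := by
          refine Finset.prod_le_prod' fun k _ => ?_
          rw [← lintegral_map hgm (hB k), hlaw]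
          exact lintegral_exp_inner_sq_uniformSphere_le (hH1 y) hα0 hα1
      _ = _ := by
          rw [Finset.prod_const, ENNReal.ofReal_pow (by positivity)]
  let X : Ω → (S → F) := fun ω k => B k ω
  have hX : Measurable X := measurable_pi_lambda _ fun k => hB k
  have hXY : IndepFun X (B j) P := by
    have h := hind.indepFun_finset S {j} (by simp [hS]) hB
    exact h.comp (φ := id) (ψ := fun z : ({j} : Finset κ) → F => z ⟨j, by simp⟩) measurable_id
      (measurable_pi_apply _)
  let G : (S → F) × F → ENNReal := fun z =>
    ENNReal.ofReal (Real.exp (t * ∑ k : S, inner ℝ (z.1 k) (H z.2) ^ 2))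
  have hGm : Measurable G := by
    refine ENNReal.measurable_ofReal.comp (Real.measurable_exp.comp (Measurable.const_mul
      (Finset.measurable_sum _ fun k _ => Measurable.pow_const (Measurable.inner ?_ ?_) 2) t))
    · exact (measurable_pi_apply k).comp measurable_fst
    · exact hH.comp measurable_snd
  have hG : ∀ ω y, G (X ω, y) = ENNReal.ofReal (Real.exp (t * ∑ k ∈ S, inner ℝ (B k ω) (H y) ^ 2)) :=
    fun ω y => by
      simp only [G, X]
      rw [← Finset.sum_coe_sort S]
  calc _ = ∫⁻ ω, G (X ω, B j ω) ∂P := lintegral_congr fun ω => (hG ω _).symm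
    _ = ∫⁻ z, G z ∂((P.map X).prod (P.map (B j))) := by
        rw [← hXY.map_prod_eq_prod_map_map hX.aemeasurable (hB j).aemeasurable,
          lintegral_map hGm (hX.prodMk (hB j))]
    _ = ∫⁻ y, ∫⁻ ω, G (X ω, y) ∂P ∂(P.map (B j)) := by
        have := Measure.isProbabilityMeasure_map (μ := P) hX.aemeasurable
        have := Measure.isProbabilityMeasure_map (μ := P) (hB j).aemeasurable
        rw [lintegral_prod_symm _ hGm.aemeasurable]
        refine lintegral_congr fun y => ?_
        exact lintegral_map (hGm.comp measurable_prodMk_right) hX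
    _ ≤ ∫⁻ _y, ENNReal.ofReal ((√(1 - α))⁻¹ ^ S.card) ∂(P.map (B j)) := by
        refine lintegral_mono fun y => ?_
        simp only [hG]
        exact hfix y
    _ = _ := by
        have := Measure.isProbabilityMeasure_map (μ := P) (hB j).aemeasurable
        simp

theorem inv_sqrt_nine_tenths_le : (√(1 - 1 / 10 : ℝ))⁻¹ ≤ Real.exp 0.053 := by
  rw [inv_le_comm₀ (by positivity) (Real.exp_pos _), ← Real.exp_neg]
  apply Real.le_sqrt_of_sq_le
  rw [← Real.exp_nat_mul, show ((2 : ℕ) : ℝ) * -0.053 = -0.106 by norm_num, Real.exp_neg,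
    inv_le_comm₀ (Real.exp_pos _) (by norm_num)]
  refine le_trans ?_ (Real.quadratic_le_exp_of_nonneg (by norm_num))
  norm_num

/-- Chernoff with `α = 1 / 10`: the exponent is `d / 20` times the sum, and each column contributes
at most `exp 0.053`. A small `α` keeps the leading constant `20 * 0.053 = 1.06` close to 1. -/
theorem measure_exists_sum_inner_sq_ge_le [DecidableEq κ] [Nontrivial F]
    (hB : ∀ k, Measurable (B k))
    (hind : iIndepFun B P) (hlaw : ∀ k, P.map (B k) = uniformSphere F) {H : F → F}
    (hH : Measurable H) (hH1 : ∀ x, ‖H x‖ ≤ 1) {q : ℝ} (hq : 0 < q) :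
    P {ω | ∃ j, 20 / Module.finrank ℝ F * (0.053 * Fintype.card κ + Real.log (1 / q)) ≤
        ∑ k ∈ Finset.univ.erase j, inner ℝ (B k ω) (H (B j ω)) ^ 2} ≤
      Fintype.card κ * ENNReal.ofReal q := by
  have hdpos : (0 : ℝ) < Module.finrank ℝ F := by
    exact_mod_cast Module.finrank_pos (R := ℝ) (M := F)
  set d : ℝ := (Module.finrank ℝ F : ℝ) with hd
  set τ : ℝ := 20 / d * (0.053 * Fintype.card κ + Real.log (1 / q)) with hτ
  have hj : ∀ j, P {ω | τ ≤ ∑ k ∈ Finset.univ.erase j, inner ℝ (B k ω) (H (B j ω)) ^ 2} ≤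
      ENNReal.ofReal q := by
    intro j
    have h0 := lintegral_exp_sum_inner_sq_le hB hind hlaw hH hH1 j (α := 1 / 10) (by norm_num)
      (by norm_num)
    have hmeas : Measurable fun ω =>
        ∑ k ∈ Finset.univ.erase j, inner ℝ (B k ω) (H (B j ω)) ^ 2 :=
      Finset.measurable_sum _ fun k _ =>
        ((hB k).inner (hH.comp (hB j))).pow_const 2
    refine (measure_le_exp_moment hmeas _ τ (by positivity) h0).trans
      (ENNReal.ofReal_le_ofReal ?_)
    have e2 : q = Real.exp (-Real.log (1 / q)) := by
      rw [one_div, Real.log_inv, neg_neg, Real.exp_log hq]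
    have e3 : (√(1 - 1 / 10 : ℝ))⁻¹ ^ (Finset.univ.erase j).card ≤
        Real.exp (Fintype.card κ * 0.053) := by
      calc _ ≤ Real.exp 0.053 ^ (Finset.univ.erase j).card :=
            pow_le_pow_left₀ (by positivity) inv_sqrt_nine_tenths_le _
        _ ≤ Real.exp 0.053 ^ Fintype.card κ :=
            pow_le_pow_right₀ (Real.one_le_exp (by norm_num)) (Finset.card_le_univ _)
        _ = _ := by rw [← Real.exp_nat_mul]
    have e4 : 1 / 10 * d / 2 * τ = 0.053 * Fintype.card κ + Real.log (1 / q) := by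
      rw [hτ]; field_simp; ring
    rw [← hd, e4]
    calc _ ≤ Real.exp (-(0.053 * Fintype.card κ + Real.log (1 / q))) *
          Real.exp (Fintype.card κ * 0.053) := by gcongr
      _ = q := by
          rw [← Real.exp_add]
          nth_rw 2 [e2]
          congr 1
          ring
  calc P {ω | ∃ j, τ ≤ ∑ k ∈ Finset.univ.erase j, inner ℝ (B k ω) (H (B j ω)) ^ 2}
      = P (⋃ j, {ω | τ ≤ ∑ k ∈ Finset.univ.erase j, inner ℝ (B k ω) (H (B j ω)) ^ 2}) := by
        congr 1; ext ω; simp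
    _ ≤ ∑ j, P {ω | τ ≤ ∑ k ∈ Finset.univ.erase j, inner ℝ (B k ω) (H (B j ω)) ^ 2} :=
        measure_iUnion_fintype_le _ _
    _ ≤ ∑ _j : κ, ENNReal.ofReal q := Finset.sum_le_sum fun j _ => hj j
    _ = _ := by simp

end Outliers

/-! ### Deterministic cost bounds and recovery of the subspace. -/

section Recovery

variable {M nₒ nᵢ r : ℕ} {U : Submodule ℝ (EuclideanSpace ℝ (Fin M))}
  {d : Fin nₒ ⊕ Fin nᵢ → EuclideanSpace ℝ (Fin M)}

theorem span_eq_of_forall_sum_abs_inner_pos {κ : Type*} [Fintype κ]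
    {a : κ → EuclideanSpace ℝ (Fin M)} (ha : ∀ i, a i ∈ U)
    (hpos : ∀ u ∈ U, ‖u‖ = 1 → 0 < ∑ i, |inner ℝ (a i) u|) :
    Submodule.span ℝ (Set.range a) = U := by
  have hle : Submodule.span ℝ (Set.range a) ≤ U :=
    Submodule.span_le.2 (Set.range_subset_iff.2 ha)
  have hbot : (Submodule.span ℝ (Set.range a))ᗮ ⊓ U = ⊥ := by
    rw [Submodule.eq_bot_iff]
    rintro u ⟨hu1, hu2⟩
    by_contra h0
    have hn : ‖u‖ ≠ 0 := norm_ne_zero_iff.2 h0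
    have h := hpos (‖u‖⁻¹ • u) (U.smul_mem _ hu2)
      (by rw [norm_smul, norm_inv, norm_norm, inv_mul_cancel₀ hn])
    refine h.ne' (Finset.sum_eq_zero fun i _ => ?_)
    rw [inner_smul_right, (Submodule.mem_orthogonal _ _).1 hu1 _
      (Submodule.subset_span (Set.mem_range_self i)), mul_zero, abs_zero]
  have := Submodule.sup_orthogonal_inf_of_hasOrthogonalProjection hle
  rwa [hbot, sup_bot_eq] at this

/-- A selection containing an outlier contains every inlier, so its span contains `U`; dimension `r`
forces equality, contradicting that the outlier is not in `U`. A selection of inliers only spans an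
`r`-dimensional subspace of `U`. -/
theorem recoversExactly_of_lt (hU : Module.finrank ℝ U = r) {x : Fin nₒ ⊕ Fin nᵢ → ℝ}
    (hx : ∀ i j, x (Sum.inr i) < x (Sum.inl j)) (hin : ∀ i, d (Sum.inr i) ∈ U)
    (hout : ∀ j, d (Sum.inl j) ∉ U)
    (hspan : Submodule.span ℝ (Set.range fun i => d (Sum.inr i)) = U) :
    RecoversExactly d x r U := by
  have himage : d '' Set.range Sum.inr = Set.range fun i => d (Sum.inr i) := by
    rw [← Set.range_comp]; rfl
  refine ⟨⟨Set.range Sum.inr, ?_, ?_⟩, ?_⟩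
  · rintro _ ⟨i, rfl⟩ l hl
    rcases l with j | i'
    · exact (hx i j).le
    · exact absurd ⟨i', rfl⟩ hl
  · rw [himage, hspan, hU]
  · rintro S ⟨hS, hr⟩
    have hSin : ∀ j, Sum.inl j ∉ S := by
      intro j hj
      have hall : ∀ i, (Sum.inr i : Fin nₒ ⊕ Fin nᵢ) ∈ S := by
        intro i
        by_contra hi
        exact absurd (hS _ hj _ hi) (not_le.2 (hx i j))
      have hUS : U ≤ Submodule.span ℝ (d '' S) := by
        rw [← hspan]
        refine Submodule.span_mono ?_
        rintro _ ⟨i, rfl⟩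
        exact ⟨_, hall i, rfl⟩
      have heq := Submodule.eq_of_le_of_finrank_eq hUS (by rw [hU, hr])
      exact hout j (heq ▸ Submodule.subset_span ⟨_, hj, rfl⟩)
    refine Submodule.eq_of_le_of_finrank_eq (Submodule.span_le.2 ?_) (by rw [hU, hr])
    rintro _ ⟨k, hk, rfl⟩
    rcases k with j | i
    · exact absurd hk (hSin j)
    · exact hin i

/-- The unit vector orthogonal to `U` in the direction of `x`, zero if `x ∈ U`. -/
noncomputable def orthogonalDirection (U : Submodule ℝ (EuclideanSpace ℝ (Fin M)))
    (x : EuclideanSpace ℝ (Fin M)) : EuclideanSpace ℝ (Fin M) :=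
  ‖x - U.starProjection x‖⁻¹ • (x - U.starProjection x)

theorem measurable_orthogonalDirection : Measurable (orthogonalDirection U) := by
  have h : Measurable fun x => x - U.starProjection x :=
    measurable_id.sub U.starProjection.continuous.measurable
  exact h.norm.inv.smul h

theorem norm_orthogonalDirection_le (x : EuclideanSpace ℝ (Fin M)) :
    ‖orthogonalDirection U x‖ ≤ 1 := by
  rw [orthogonalDirection, norm_smul, norm_inv, norm_norm]
  exact inv_mul_le_one

/-- Inliers only see the projection `p` of `c` to `U`, and Cauchy–Schwarz in `⟨d i, p⟩ = 1` gives
`‖p‖ ≥ 1`. The outlier terms are dropped. -/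
theorem le_l1Corr_inlier (hin : ∀ i, d (Sum.inr i) ∈ U) {m : ℝ} (hm : 0 ≤ m)
    (hlow : ∀ u ∈ U, ‖u‖ = 1 → m ≤ ∑ i, |inner ℝ (d (Sum.inr i)) u|) {i : Fin nᵢ}
    (hi : ‖d (Sum.inr i)‖ = 1) {c : EuclideanSpace ℝ (Fin M)}
    (hc : inner ℝ (d (Sum.inr i)) c = 1) : m ≤ l1Corr d c := by
  set p := U.starProjection c with hp
  have hpU : p ∈ U := U.starProjection_apply_mem c
  have hinner : ∀ k, inner ℝ (d (Sum.inr k)) c = inner ℝ (d (Sum.inr k)) p := fun k => by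
    rw [← sub_eq_zero, ← inner_sub_right]
    exact Submodule.sub_starProjection_mem_orthogonal c _ (hin k)
  have hp1 : 1 ≤ ‖p‖ := by
    have := real_inner_le_norm (d (Sum.inr i)) p
    rwa [← hinner, hc, hi, one_mul] at this
  have hp0 : ‖p‖ ≠ 0 := by positivity
  have h1 := hlow (‖p‖⁻¹ • p) (U.smul_mem _ hpU)
    (by rw [norm_smul, norm_inv, norm_norm, inv_mul_cancel₀ hp0])
  calc m ≤ ‖p‖ * m := le_mul_of_one_le_left hm hp1
    _ ≤ ‖p‖ * ∑ k, |inner ℝ (d (Sum.inr k)) (‖p‖⁻¹ • p)| := by gcongr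
    _ = ∑ k, |inner ℝ (d (Sum.inr k)) c| := by
        rw [Finset.mul_sum]
        refine Finset.sum_congr rfl fun k _ => ?_
        rw [inner_smul_right, abs_mul, abs_of_nonneg (by positivity), ← mul_assoc,
          mul_inv_cancel₀ hp0, one_mul, hinner]
    _ ≤ l1Corr d c := by
        rw [l1Corr, Fintype.sum_sum_type]
        exact le_add_of_nonneg_left (Finset.sum_nonneg fun _ _ => abs_nonneg _)

/-- The competitor is `w / ‖w‖²`, with `w` the component of the outlier orthogonal to `U`. It
annihilates the inliers, the outlier itself contributes 1, and Cauchy–Schwarz bounds the rest. The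
factor `1.155` bounds `‖w‖⁻¹`, as `‖w‖² ≥ 3 / 4`. -/
theorem l1Corr_outlier_le (hin : ∀ i, d (Sum.inr i) ∈ U) {j : Fin nₒ}
    (hj : ‖d (Sum.inl j)‖ = 1) (hproj : ‖U.starProjection (d (Sum.inl j))‖ ^ 2 ≤ 1 / 4) {τ : ℝ}
    (hτ : ∑ k ∈ Finset.univ.erase j,
      inner ℝ (d (Sum.inl k)) (orthogonalDirection U (d (Sum.inl j))) ^ 2 ≤ τ)
    {c : EuclideanSpace ℝ (Fin M)} (hc : IsOptimalDirection d (d (Sum.inl j)) c) :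
    l1Corr d c ≤ 1 + 1.155 * √(nₒ * τ) := by
  set x := d (Sum.inl j) with hx
  set w := x - U.starProjection x with hw
  have hwo : ∀ u ∈ U, inner ℝ u w = 0 := fun u hu =>
    Submodule.sub_starProjection_mem_orthogonal x _ hu
  have hsum : x = w + U.starProjection x := by rw [hw]; abel
  have hxw : inner ℝ x w = ‖w‖ ^ 2 := by
    conv_lhs => rw [hsum]
    rw [inner_add_left, real_inner_self_eq_norm_sq, hwo _ (U.starProjection_apply_mem x), add_zero]
  have hw2 : 3 / 4 ≤ ‖w‖ ^ 2 := by
    have h1 : ‖x‖ ^ 2 = ‖w‖ ^ 2 + ‖U.starProjection x‖ ^ 2 := by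
      conv_lhs => rw [hsum]
      rw [norm_add_sq_real, real_inner_comm, hwo _ (U.starProjection_apply_mem x)]
      ring
    rw [hj] at h1
    linarith
  have hw1 : 0.866 ≤ ‖w‖ := by
    refine le_of_sq_le_sq ?_ (norm_nonneg w)
    linarith
  have hw0 : ‖w‖ ≠ 0 := by positivity
  have hinv : ‖w‖⁻¹ ≤ 1.155 := by
    rw [inv_le_comm₀ (by positivity) (by norm_num)]
    refine le_trans ?_ hw1
    norm_num
  set h := orthogonalDirection U x with hh
  have hh' : h = ‖w‖⁻¹ • w := rfl
  have hfeas : inner ℝ x (‖w‖⁻¹ • h) = 1 := by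
    rw [hh', inner_smul_right, inner_smul_right, hxw]
    field_simp
  refine (hc.2 _ hfeas).trans ?_
  have hzero : ∑ i, |inner ℝ (d (Sum.inr i)) (‖w‖⁻¹ • h)| = 0 := by
    refine Finset.sum_eq_zero fun i _ => ?_
    rw [hh', inner_smul_right, inner_smul_right, hwo _ (hin i), mul_zero, mul_zero, abs_zero]
  have hcs : ∑ k ∈ Finset.univ.erase j, |inner ℝ (d (Sum.inl k)) h| ≤ √(nₒ * τ) := by
    refine Real.le_sqrt_of_sq_le (sq_sum_le_card_mul_sum_sq.trans ?_)
    simp only [sq_abs]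
    have hcard : ((Finset.univ.erase j).card : ℝ) ≤ nₒ := by
      exact_mod_cast (Finset.card_le_univ _).trans (by simp)
    exact mul_le_mul hcard hτ (Finset.sum_nonneg fun _ _ => sq_nonneg _) (by positivity)
  rw [l1Corr, Fintype.sum_sum_type, hzero, add_zero,
    ← Finset.add_sum_erase _ _ (Finset.mem_univ j), ← hx, hfeas, abs_one]
  have : ∑ k ∈ Finset.univ.erase j, |inner ℝ (d (Sum.inl k)) (‖w‖⁻¹ • h)| =
      ‖w‖⁻¹ * ∑ k ∈ Finset.univ.erase j, |inner ℝ (d (Sum.inl k)) h| := by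
    rw [Finset.mul_sum]
    refine Finset.sum_congr rfl fun k _ => ?_
    rw [inner_smul_right, abs_mul, abs_of_nonneg (by positivity)]
  rw [this]
  have := mul_le_mul hinv hcs (Finset.sum_nonneg fun _ _ => abs_nonneg _) (by norm_num)
  linarith

theorem one_le_chi (hnₒ : 1 ≤ nₒ) (hout : ∀ j, ‖d (Sum.inl j)‖ = 1)
    {C : Fin nₒ ⊕ Fin nᵢ → EuclideanSpace ℝ (Fin M)}
    (hC : ∀ k, IsOptimalDirection d (d k) (C k)) : 1 ≤ chi C := by
  have h1 : 1 ≤ ‖C (Sum.inl ⟨0, hnₒ⟩)‖ := by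
    have := real_inner_le_norm (d (Sum.inl ⟨0, hnₒ⟩)) (C (Sum.inl ⟨0, hnₒ⟩))
    rwa [(hC _).1, hout, one_mul] at this
  exact h1.trans (le_ciSup (f := fun j : Fin nₒ => ‖C (Sum.inl j)‖)
    (Set.finite_range _).bddAbove _)

end Recovery

/-! ### Numerical consequences of the conditions. -/

section Arithmetic

theorem calA_gt_of_cond3 {M r nᵢ nₒ : ℕ} {δ χ : ℝ} (hχ : 1 ≤ χ) (h : Cond3 M r nᵢ nₒ δ χ) :
    nₒ / √M + 4 * √nₒ < calA nᵢ r δ := by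
  have h1 : (nₒ : ℝ) / √M ≤ χ * (nₒ / √M) := le_mul_of_one_le_left (by positivity) hχ
  have h2 : 1 ≤ √χ := Real.one_le_sqrt.2 hχ
  have h3 : 2 * √nₒ * (1 + 1) ≤ 2 * √(nₒ : ℝ) * (1 + √χ) := by gcongr
  have h4 := Real.sqrt_nonneg (2 * χ * nₒ * Real.log (1 / δ) / (M - 1))
  have h5 : _ < calA nᵢ r δ := h
  linarith

theorem nine_mul_le_of_cDelta_mul_lt {M r nₒ : ℕ} {δ : ℝ} (h : cDelta M r nₒ δ * r < M) :
    9 * (r : ℝ) ≤ M := by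
  have h1 : 9 ≤ cDelta M r nₒ δ := by
    have : (3 : ℝ) ≤ 3 * max 1 (max √(8 * M * Real.pi / ((M - 1) * r))
        √(8 * M * Real.log (nₒ / δ) / ((M - 1) * r))) := by
      linarith [le_max_left (1 : ℝ) (max √(8 * M * Real.pi / ((M - 1) * r))
        √(8 * M * Real.log (nₒ / δ) / ((M - 1) * r)))]
    have := pow_le_pow_left₀ (by norm_num) this 2
    rw [cDelta]
    linarith
  have := mul_le_mul_of_nonneg_right h1 (Nat.cast_nonneg (α := ℝ) r)
  linarith

/-- The last term of the maximum in `cDelta`, squared, gives `72 M log (nₒ / δ) / (M - 1) ≤ c_δ r <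
M`. -/
theorem log_le_of_cDelta_mul_lt {M r nₒ : ℕ} {δ : ℝ} (hr : 1 ≤ r)
    (h : cDelta M r nₒ δ * r < M) (hl : 0 ≤ Real.log (nₒ / δ)) :
    72 * Real.log (nₒ / δ) ≤ M := by
  have hr' : (1 : ℝ) ≤ r := by exact_mod_cast hr
  have hM := nine_mul_le_of_cDelta_mul_lt h
  have hM1 : (0 : ℝ) < M - 1 := by linarith
  set l := Real.log (nₒ / δ)
  have h0 : 0 ≤ 8 * M * l / ((M - 1) * r) := by positivity
  have h1 : 72 * M * l / ((M - 1) * r) ≤ cDelta M r nₒ δ := by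
    have h2 : √(8 * M * l / ((M - 1) * r)) ≤ max 1 (max √(8 * M * Real.pi / ((M - 1) * r))
        √(8 * M * l / ((M - 1) * r))) := (le_max_right _ _).trans (le_max_right _ _)
    have h3 := pow_le_pow_left₀ (Real.sqrt_nonneg _) h2 2
    rw [Real.sq_sqrt h0] at h3
    rw [cDelta, mul_pow]
    calc 72 * M * l / ((M - 1) * r) = 3 ^ 2 * (8 * M * l / ((M - 1) * r)) := by ring
      _ ≤ _ := by gcongr
  have h4 : 72 * M * l / ((M - 1) * r) * r < M :=
    (mul_le_mul_of_nonneg_right h1 (by positivity)).trans_lt h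
  have h5 : 72 * M * l / ((M - 1) * r) * r = M * (72 * l / (M - 1)) := by field_simp
  rw [h5] at h4
  have h6 : 72 * l / (M - 1) < 1 := by
    have hMpos : (0 : ℝ) < M := by linarith
    by_contra hcon
    have := mul_le_mul_of_nonneg_left (not_lt.1 hcon) hMpos.le
    linarith
  rw [div_lt_one hM1] at h6
  linarith

/-- With `Y = √(nᵢ / (2πr))` and `e = √(log (1/δ) / (2r - 2))`, `𝒜 = √nᵢ (Y - (1 + e))`, so
positivity of `𝒜` means `Y > 1 + e`. Moreover `nᵢ = 2πrY²` and `2r + log (1/δ) ≤ 2r(1 + e)²`, so the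
claim reduces to a quadratic inequality in `Y` and `1 + e`. -/
theorem calA_le_of_sum_ge {nᵢ r : ℕ} {δ f : ℝ} (hr : 2 ≤ r) (hδ0 : 0 < δ) (hδ1 : δ < 1)
    (hA : 0 < calA nᵢ r δ)
    (hf : 0.3864 * nᵢ - (2 * r + Real.log (1 / δ)) ≤ 0.8 * √r * f) :
    1.21 * calA nᵢ r δ ≤ f := by
  have hr' : (2 : ℝ) ≤ r := by exact_mod_cast hr
  have hL : 0 ≤ Real.log (1 / δ) := Real.log_nonneg (by rw [le_div_iff₀ hδ0]; linarith)
  have hpi := Real.pi_pos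
  set L := Real.log (1 / δ)
  set x := √(r : ℝ) with hx
  set k := √(1 / (2 * Real.pi)) with hk
  set S := √(nᵢ : ℝ) with hS
  set e := √(L / (2 * r - 2)) with he
  have hx0 : 0 < x := Real.sqrt_pos.2 (by linarith)
  have hxx : x ^ 2 = r := Real.sq_sqrt (by linarith)
  have hk0 : 0 < k := Real.sqrt_pos.2 (by positivity)
  have hkk : k ^ 2 * (2 * Real.pi) = 1 := by
    rw [hk, Real.sq_sqrt (by positivity)]; field_simp
  have hSS : S ^ 2 = nᵢ := Real.sq_sqrt (by positivity)
  have hS0 : 0 ≤ S := Real.sqrt_nonneg _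
  have he0 : 0 ≤ e := Real.sqrt_nonneg _
  have hee : e ^ 2 * (2 * r - 2) = L := by
    rw [he, Real.sq_sqrt (div_nonneg hL (by linarith))]
    exact div_mul_cancel₀ _ (by linarith)
  have hsqrt : √(nᵢ * L / (2 * r - 2)) = S * e := by
    rw [mul_div_assoc, Real.sqrt_mul (by positivity)]
  set Y := k * S / x with hY
  have hcalA : calA nᵢ r δ = S * (Y - (1 + e)) := by
    rw [calA, hsqrt, ← hk, ← hS, ← hx, ← hSS, hY]
    field_simp
    ring
  rw [hcalA] at hA ⊢
  have hYD : 0 < Y - (1 + e) := by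
    by_contra hcon
    have := mul_nonpos_of_nonneg_of_nonpos hS0 (not_lt.1 hcon)
    linarith
  have hSY : k * S = x * Y := by rw [hY]; field_simp
  have hn : (nᵢ : ℝ) = 2 * Real.pi * (r * Y ^ 2) := by
    have : (k * S) ^ 2 = (x * Y) ^ 2 := by rw [hSY]
    rw [mul_pow, mul_pow, hSS, hxx] at this
    calc (nᵢ : ℝ) = (k ^ 2 * (2 * Real.pi)) * nᵢ := by rw [hkk, one_mul]
      _ = 2 * Real.pi * (k ^ 2 * nᵢ) := by ring
      _ = _ := by rw [this]
  have hLr : 2 * r + L ≤ 2 * r * (1 + e) ^ 2 := by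
    have h1 : 0 ≤ r * e := by positivity
    nlinarith [sq_nonneg e]
  have hkinv : 0.968 ≤ 2.4278 * k := by
    have : (0.3988 : ℝ) ≤ k := by
      apply Real.le_sqrt_of_sq_le
      rw [le_div_iff₀ (by positivity)]
      have := Real.pi_lt_d6
      norm_num at this ⊢
      linarith
    linarith
  have hpi2 : 2.4278 ≤ 0.3864 * (2 * Real.pi) := by
    have := Real.pi_gt_d6
    norm_num at this ⊢
    linarith
  refine le_of_mul_le_mul_left ?_ (show 0 < 0.8 * x * k by positivity)
  calc 0.8 * x * k * (1.21 * (S * (Y - (1 + e))))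
      = 0.968 * x * (k * S) * (Y - (1 + e)) := by ring
    _ = 0.968 * (r * (Y * (Y - (1 + e)))) := by rw [hSY, ← hxx]; ring
    _ ≤ 2.4278 * k * (r * (Y * (Y - (1 + e)))) := by
        refine mul_le_mul_of_nonneg_right hkinv ?_
        have : 0 ≤ Y := by linarith
        positivity
    _ = k * (r * (2.4278 * (Y * (Y - (1 + e))))) := by ring
    -- Equivalent to `2 (1 + e)² ≤ 2.4278 Y (1 + e)`, which follows from `Y > 1 + e`.
    _ ≤ k * (r * (2.4278 * Y ^ 2 - 2 * (1 + e) ^ 2)) := by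
        gcongr
        nlinarith [mul_pos (show 0 < 1 + e by linarith) hYD, sq_nonneg (1 + e)]
    _ ≤ k * (0.3864 * nᵢ - (2 * r + L)) := by
        refine mul_le_mul_of_nonneg_left ?_ hk0.le
        have : 2.4278 * (r * Y ^ 2) ≤ 0.3864 * (2 * Real.pi) * (r * Y ^ 2) :=
          mul_le_mul_of_nonneg_right hpi2 (by positivity)
        rw [hn]
        linarith
    _ ≤ k * (0.8 * x * f) := by gcongr
    _ = 0.8 * x * k * f := by ring

/-- The square root is at most `1.03 nₒ / √M + 0.53 √nₒ`, since `1.03² ≥ 1.06` and `0.53² ≥ 20 /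
72`. Then `1.155 * 1.03 < 1.21`, and the summand 1 is absorbed by `√nₒ ≥ 1`. -/
theorem outlier_bound_lt {M nₒ : ℕ} {l : ℝ} (hM : 0 < M) (hnₒ : 1 ≤ nₒ)
    (hl72 : 72 * l ≤ M) :
    1 + 1.155 * √(nₒ * (20 / M * (0.053 * nₒ + l))) < 1.21 * (nₒ / √M + 4 * √nₒ) := by
  have hn : (1 : ℝ) ≤ nₒ := by exact_mod_cast hnₒ
  have hM' : (0 : ℝ) < M := by exact_mod_cast hM
  have hs : 1 ≤ √(nₒ : ℝ) := Real.one_le_sqrt.2 hn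
  have hsM : 0 < √(M : ℝ) := Real.sqrt_pos.2 hM'
  have h1 : √(nₒ * (20 / M * (0.053 * nₒ + l))) ≤ 1.03 * (nₒ / √M) + 0.53 * √nₒ := by
    apply Real.sqrt_le_iff.2 ⟨by positivity, ?_⟩
    have e1 : (nₒ * (20 / M * (0.053 * nₒ + l)) : ℝ) =
        1.06 * (nₒ / √M) ^ 2 + 20 / 72 * nₒ * (72 * l / M) := by
      rw [div_pow, Real.sq_sqrt hM'.le]
      field_simp
      ring
    have e2 : 72 * l / M ≤ 1 := (div_le_one hM').2 hl72
    have e3 : 20 / 72 * (nₒ : ℝ) * (72 * l / M) ≤ 20 / 72 * nₒ * 1 :=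
      mul_le_mul_of_nonneg_left e2 (by positivity)
    have e4 : √(nₒ : ℝ) ^ 2 = nₒ := Real.sq_sqrt (by positivity)
    have e5 : 0 ≤ nₒ / √M * √(nₒ : ℝ) := by positivity
    rw [e1]
    nlinarith [sq_nonneg ((nₒ : ℝ) / √M)]
  have h2 : (0 : ℝ) ≤ nₒ / √M := by positivity
  linarith

end Arithmetic

/-! ### The good event and its consequences. -/

section Main

variable {M r nₒ nᵢ : ℕ} {U : Submodule ℝ (EuclideanSpace ℝ (Fin M))} {δ : ℝ}

/-- The deterministic properties of the columns that imply exact recovery. -/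
structure IsGoodData (U : Submodule ℝ (EuclideanSpace ℝ (Fin M)))
    (d : Fin nₒ ⊕ Fin nᵢ → EuclideanSpace ℝ (Fin M)) (δ : ℝ) : Prop where
  norm_outlier : ∀ j, ‖d (Sum.inl j)‖ = 1
  inlier : ∀ i, d (Sum.inr i) ∈ U ∧ ‖d (Sum.inr i)‖ = 1
  projection : ∀ j, ‖U.starProjection (d (Sum.inl j))‖ ^ 2 ≤ 1 / 4
  outlier_corr : ∀ j, ∑ k ∈ Finset.univ.erase j,
    inner ℝ (d (Sum.inl k)) (orthogonalDirection U (d (Sum.inl j))) ^ 2 ≤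
      20 / M * (0.053 * nₒ + Real.log (nₒ / δ))
  inlier_corr : ∀ u ∈ U, ‖u‖ = 1 →
    0.3864 * nᵢ - (2 * Module.finrank ℝ U + Real.log (1 / δ)) ≤
      0.8 * √(Module.finrank ℝ U) * ∑ i, |inner ℝ (d (Sum.inr i)) u|

theorem IsGoodData.recovers {d : Fin nₒ ⊕ Fin nᵢ → EuclideanSpace ℝ (Fin M)}
    (h : IsGoodData U d δ) (hU : Module.finrank ℝ U = r) (hr : 2 ≤ r) (hnₒ : 1 ≤ nₒ)
    (hδ0 : 0 < δ) (hδ1 : δ < 1) (hM : 0 < M) (hlog : 72 * Real.log (nₒ / δ) ≤ M)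
    {C : Fin nₒ ⊕ Fin nᵢ → EuclideanSpace ℝ (Fin M)}
    (hC : ∀ k, IsOptimalDirection d (d k) (C k)) (hcond : Cond3 M r nᵢ nₒ δ (chi C)) :
    (∀ (i : Fin nᵢ) (j : Fin nₒ),
      innovationValue d (C (Sum.inr i)) < innovationValue d (C (Sum.inl j))) ∧
    RecoversExactly d (fun k => innovationValue d (C k)) r U := by
  have hA := calA_gt_of_cond3 (one_le_chi hnₒ h.norm_outlier hC) hcond
  have hA0 : 0 < calA nᵢ r δ := lt_of_le_of_lt (by positivity) hA
  have hlow : ∀ u ∈ U, ‖u‖ = 1 → 1.21 * calA nᵢ r δ ≤ ∑ i, |inner ℝ (d (Sum.inr i)) u| := by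
    intro u hu hu1
    have := h.inlier_corr u hu hu1
    rw [hU] at this
    exact calA_le_of_sum_ge hr hδ0 hδ1 hA0 this
  have hlt : ∀ (i : Fin nᵢ) (j : Fin nₒ),
      innovationValue d (C (Sum.inr i)) < innovationValue d (C (Sum.inl j)) := by
    intro i j
    have h1 := le_l1Corr_inlier (fun i => (h.inlier i).1) (by positivity) hlow (h.inlier i).2
      (hC (Sum.inr i)).1
    have h2 := l1Corr_outlier_le (fun i => (h.inlier i).1) (h.norm_outlier j) (h.projection j)
      (h.outlier_corr j) (hC (Sum.inl j))
    have h3 := outlier_bound_lt hM hnₒ hlog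
    have h4 : 0 < l1Corr d (C (Sum.inl j)) := by
      have h5 : |inner ℝ (d (Sum.inl j)) (C (Sum.inl j))| ≤ l1Corr d (C (Sum.inl j)) :=
        Finset.single_le_sum (f := fun k => |inner ℝ (d k) (C (Sum.inl j))|)
          (fun k _ => abs_nonneg _) (Finset.mem_univ _)
      rw [(hC (Sum.inl j)).1, abs_one] at h5
      linarith
    exact one_div_lt_one_div_of_lt h4 (by linarith)
  refine ⟨hlt, recoversExactly_of_lt hU hlt (fun i => (h.inlier i).1) (fun j hj => ?_)
    (span_eq_of_forall_sum_abs_inner_pos (fun i => (h.inlier i).1) fun u hu hu1 =>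
      lt_of_lt_of_le (by positivity) (hlow u hu hu1))⟩
  -- An outlier in `U` would be its own projection, giving `1 ≤ 1 / 4`.
  have := h.projection j
  rw [Submodule.starProjection_eq_self_iff.2 hj, h.norm_outlier] at this
  norm_num at this

/-- The inlier bound costs `2 * δ`. The two outlier bounds cost `δ` each, through `q = δ / nₒ` in
the union bounds over the outliers. -/
theorem IsRandomData.measure_not_isGoodData_le {Ω : Type*} [MeasurableSpace Ω] {P : Measure Ω}
    [IsProbabilityMeasure P] {D : Fin nₒ ⊕ Fin nᵢ → Ω → EuclideanSpace ℝ (Fin M)}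
    (hD : IsRandomData P U D) (hU : 0 < Module.finrank ℝ U) (hnₒ : 1 ≤ nₒ) (hδ0 : 0 < δ)
    (h9 : 9 * (Module.finrank ℝ U : ℝ) ≤ M) (h72 : 72 * Real.log (nₒ / δ) ≤ M) :
    P {ω | ¬ IsGoodData U (fun l => D l ω) δ} ≤ ENNReal.ofReal (4 * δ) := by
  have hn : (0 : ℝ) < nₒ := by exact_mod_cast hnₒ
  have hfin : (Module.finrank ℝ (EuclideanSpace ℝ (Fin M)) : ℝ) = M := by simp
  have hUM : 0 < M := by
    have : (0 : ℝ) < Module.finrank ℝ U := by exact_mod_cast hU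
    have : (0 : ℝ) < M := by linarith
    exact_mod_cast this
  have : Nontrivial (EuclideanSpace ℝ (Fin M)) :=
    Module.nontrivial_of_finrank_pos (R := ℝ) (by simpa using hUM)
  have hlog : Real.log (1 / (δ / nₒ)) = Real.log (nₒ / δ) := by rw [one_div_div]
  have b1 := measure_exists_sum_abs_inner_lt_le (P := P) (U := U) hU
    (fun i => hD.measurable (Sum.inr i)) (hD.indep.precomp Sum.inr_injective) hD.inlier_law hδ0
  have b2 := measure_exists_norm_sq_projection_ge_le (P := P)
    (fun j => hD.measurable (Sum.inl j)) hD.outlier_law U (q := δ / nₒ) (by positivity)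
    (by rwa [hfin]) (by rwa [hfin, hlog])
  have b3 := measure_exists_sum_inner_sq_ge_le (P := P)
    (fun j => hD.measurable (Sum.inl j)) (hD.indep.precomp Sum.inl_injective) hD.outlier_law
    (measurable_orthogonalDirection (U := U)) norm_orthogonalDirection_le (q := δ / nₒ)
    (by positivity)
  rw [Fintype.card_fin] at b1 b2 b3
  rw [hfin, hlog] at b3
  have hq : (nₒ : ENNReal) * ENNReal.ofReal (δ / nₒ) = ENNReal.ofReal δ := by
    rw [← ENNReal.ofReal_natCast, ← ENNReal.ofReal_mul hn.le]
    congr 1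
    field_simp
  rw [hq] at b2 b3
  have hae : ∀ᵐ ω ∂P, (∀ j, ‖D (Sum.inl j) ω‖ = 1) ∧
      ∀ i, D (Sum.inr i) ω ∈ U ∧ ‖D (Sum.inr i) ω‖ = 1 := by
    refine Filter.Eventually.and (ae_all_iff.2 fun j => ?_) (ae_all_iff.2 fun i => ?_)
    · exact ae_of_ae_map (hD.measurable (Sum.inl j)).aemeasurable
        (by rw [hD.outlier_law]; exact ae_norm_eq_one_uniformSphere)
    · exact ae_of_ae_map (hD.measurable (Sum.inr i)).aemeasurable
        (by rw [hD.inlier_law]; exact ae_uniformSphereIn)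
  refine le_trans (measure_mono_ae ?_) ((measure_union_le _ _).trans
    (add_le_add b1 ((measure_union_le _ _).trans (add_le_add b2 b3)))) |>.trans (le_of_eq ?_)
  · filter_upwards [hae] with ω hω hbad
    change ω ∈ (_ : Set Ω) ∪ (_ ∪ _)
    by_contra hcon
    simp only [Set.mem_union, Set.mem_ofPred_eq, not_or, not_exists, not_and, not_le,
      not_lt] at hcon
    obtain ⟨c1, c2, c3⟩ := hcon
    exact hbad ⟨hω.1, hω.2, fun j => (c2 j).le, fun j => (c3 j).le, c1⟩
  · rw [← ENNReal.ofReal_add hδ0.le hδ0.le, ← ENNReal.ofReal_add (by positivity) (by positivity)]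
    congr 1
    ring

end Main

end InnovationSearch

theorem theorem1 {Ω : Type*} [MeasurableSpace Ω] (P : Measure Ω) [IsProbabilityMeasure P]
    (M r nₒ nᵢ : ℕ) (U : Submodule ℝ (EuclideanSpace ℝ (Fin M)))
    (hU : Module.finrank ℝ U = r) (hr : 2 ≤ r) (hnₒ : 1 ≤ nₒ)
    (D : Fin nₒ ⊕ Fin nᵢ → Ω → EuclideanSpace ℝ (Fin M))
    (hD : InnovationSearch.IsRandomData P U D)
    (δ : ℝ) (hδ0 : 0 < δ) (hδ1 : δ < 1)
    (hc : InnovationSearch.cDelta M r nₒ δ * r < M) :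
    ∃ E : Set Ω, MeasurableSet E ∧ ENNReal.ofReal (1 - 7 * δ) ≤ P E ∧
      ∀ ω ∈ E, ∀ C : Fin nₒ ⊕ Fin nᵢ → EuclideanSpace ℝ (Fin M),
        (∀ k, InnovationSearch.IsOptimalDirection (fun l => D l ω) (D k ω) (C k)) →
        InnovationSearch.Cond1 M r nᵢ nₒ δ (InnovationSearch.nz (fun l => D l ω) C) →
        InnovationSearch.Cond2 M r nᵢ nₒ δ (InnovationSearch.nz (fun l => D l ω) C) →
        InnovationSearch.Cond3 M r nᵢ nₒ δ (InnovationSearch.chi C) →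
        (∀ (i : Fin nᵢ) (j : Fin nₒ),
          InnovationSearch.innovationValue (fun l => D l ω) (C (Sum.inr i)) <
            InnovationSearch.innovationValue (fun l => D l ω) (C (Sum.inl j))) ∧
        InnovationSearch.RecoversExactly (fun l => D l ω)
          (fun k => InnovationSearch.innovationValue (fun l => D l ω) (C k)) r U := by
  have hr' : (2 : ℝ) ≤ r := by exact_mod_cast hr
  have h9 := InnovationSearch.nine_mul_le_of_cDelta_mul_lt hc
  have hM : 0 < M := by
    have : (0 : ℝ) < M := by linarith
    exact_mod_cast this
  have hlog0 : 0 ≤ Real.log (nₒ / δ) := by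
    refine Real.log_nonneg ?_
    rw [le_div_iff₀ hδ0]
    have : (1 : ℝ) ≤ nₒ := by exact_mod_cast hnₒ
    linarith
  have h72 := InnovationSearch.log_le_of_cDelta_mul_lt (by omega) hc hlog0
  have hbad := hD.measure_not_isGoodData_le (by omega) hnₒ hδ0 (by rwa [hU]) h72
  -- Passing to a measurable hull of the bad set keeps its measure and avoids proving that the set
  -- itself is measurable.
  refine ⟨(toMeasurable P {ω | ¬ InnovationSearch.IsGoodData U (fun l => D l ω) δ})ᶜ,
    (measurableSet_toMeasurable _ _).compl, ?_, fun ω hω C hC _ _ hcond => ?_⟩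
  · rw [prob_compl_eq_one_sub (measurableSet_toMeasurable _ _), measure_toMeasurable,
      ENNReal.ofReal_sub _ (by positivity), ENNReal.ofReal_one]
    exact tsub_le_tsub_left (hbad.trans (ENNReal.ofReal_le_ofReal (by linarith))) _
  · have hgood : InnovationSearch.IsGoodData U (fun l => D l ω) δ := by
      by_contra hcon
      exact hω (subset_toMeasurable _ _ hcon)
    exact hgood.recovers hU hr hnₒ hδ0 hδ1 hM h72 hC hcond
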